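/- **Language.** The symbols are $\bullet,\ddot v,\downarrow,\forall,\varsigma,\#,\mathcal T,\mathcal F,\trianglelefteq$. The terms are the variables $v_n$ (written $\ddot v\bullet\cdots\bullet$ with $n$ dots), the primitive constants $\mathcal T,\mathcal F$, the set abstracts $\{v\mid A\}$ (written $\varsigma vA$), and the names $\ulcorner X\urcorner$ (written $\#X$) of terms and formulas $X$. The formulas are the appositions $ba$ of two terms, also written $a\in b$, and $\downarrow\! AB$ (neither $A$ nor $B$), $\forall vA$, and $a\trianglelefteq b$. A variable that is free in $X$ is free in $\ulcorner X\urcorner$. Constants are closed terms, sentences are closed formulas; $A^t_v$ is $A$ with $t$ substituted for the free occurrences of $v$; $\neg,\wedge,\vee,\to,\exists$ are defined from $\downarrow$ and $\forall$ as usual. Every term has a *chiffer*, the natural number denoted by its Polish symbol string read as a bijective base-$10$ numeral: the nine symbols, in the order listed, are the digits $1,\dots,9$, and the digit $10$ is put in front of each apposition. *Identity* is co-essentiality: $a=b$ is $\forall u(a\in u\to b\in u)$. **Semantics.** A *barber* assigns to every $n\in\mathbb N$ and every ordinal $\alpha$ a set of sentences; $\models_n^\alpha A$ says that $A$ belongs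 to it. It is required that * $\models_n^\alpha\;\downarrow\! AB$ iff neither $\models_n^\alpha A$ nor $\models_n^\alpha B$; and $\models_n^\alpha\forall vA$ iff $\models_n^\alpha A^t_v$ for all constants $t$; * for constants $a,b$: $\models_n^\alpha a\trianglelefteq b$ iff the least chiffer of a constant $x$ with $\models_n^\alpha x=a$ is at most the least chiffer of a constant $y$ with $\models_n^\alpha y=b$; * for $\alpha>0$: $\models_n^\alpha\mathcal T\ulcorner A\urcorner$ iff there is $\gamma<\alpha$ such that $\models_n^\delta A$ whenever $\gamma\le\delta<\alpha$; and $\models_n^\alpha t\in\{v\mid A\}$ iff there is $\gamma<\alpha$ such that $\models_n^\delta A^t_v$ whenever $\gamma\le\delta<\alpha$. The atomic sentences $ba$ at $\alpha=0$ are arbitrary, and so are, at each $\alpha>0$, those not governed by the last clause. Write $\models^\alpha A$ if $\models_n^\alpha A$ for all $n$. Let $\mathrm{IN}^\alpha(A)$ mean that $\models^\beta\mathcal T\ulcorner A\urcorner$ for all $\beta\ge\alpha$, and $\mathrm{IN}(A)$ that $\mathrm{IN}^\alpha(A)$ for some $\alpha$. An ordinal $\alpha$ *stabilizes* $A$ if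 $\mathrm{IN}(A)$ implies $\mathrm{IN}^\alpha(A)$ and $\models^\alpha\mathcal T\ulcorner A\urcorner$ implies $\mathrm{IN}(A)$. The *closure ordinal* $\varpi$ is the least ordinal that stabilizes all sentences. A sentence $A$ is a *maxim*, $\Vdash^M A$, if $\models^\varpi\mathcal T\ulcorner A\urcorner$, and an *optimum*, $\Vdash^O A$, if $\models^\varpi A$. A set (that is, a constant) $a$ is *orthodox* if $\Vdash^O\forall x(\mathcal T\ulcorner x\in a\urcorner\vee\mathcal T\ulcorner x\notin a\urcorner)$. **Sets.** Put $\emptyset=\{x\mid x\ne x\}$, $\mathbf U=\{x\mid x=x\}$, $a'=\{x\mid x=a\vee x\in a\}$, $\omega=\{x\mid\forall y(\emptyset\in y\wedge\forall z(z\in y\to z'\in y)\to x\in y)\}$, $\{a,b\}=\{x\mid x=a\vee x=b\}$, $(a,b)=\{\{a,a\},\{a,b\}\}$, $\{(y,z)\mid A\}=\{p\mid\exists y\exists z(p=(y,z)\wedge A)\}$, and $b\setminus c=\{x\mid x\in b\wedge x\notin c\}$. For sets $f,a,b$ let $f\backslash a\simeq b$ be the formula $\forall x\forall y\forall z((x,y)\in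 f\wedge(x,z)\in f\to y=z)\wedge(a,b)\in f$, and let $x\in f\backslash a$ be $\exists y(f\backslash a\simeq y\wedge x\in y)$. The *manifestation set* of a formula $A(y,z)$ is $\{w\mid(w,\mathbf a)\in\mathbf a\}$ with $\mathbf a=\{(y,z)\mid A(y,\{w\mid(w,z)\in z\})\}$. The *choice function* is $\mathcal S=\{(w,a)\mid a=\{x\mid x\in w\wedge\forall y(y\in w\to x\trianglelefteq y)\}\}$. The *iterated choices from* $\mathbf U$ are the manifestation set $h$ of the formula (in $p$ and $h$) $$\exists m\exists a\Big(p=(m,a)\wedge\big[(m=\emptyset\wedge\mathcal S\backslash\mathbf U\simeq a)\vee\exists n\big(n\in\omega\wedge m=n'\wedge\mathcal S\backslash(\mathbf U\setminus\{z\mid\exists i(i\in n'\wedge z\in h\backslash i)\})\simeq a\big)\big]\Big),$$ and $x\in\mathcal S^n\mathbf U$ is $x\in h\backslash n$. The *enumerator* is $E=\{(n,x)\mid n\in\omega\wedge x\in\mathcal S^n\mathbf U\}$. **Theorem.** For every barber, $E$ is orthodox, and it is a maxim that $E$ is a bijection from $\omega$ onto $\mathbf U$: the conjunction of * $\forall p(p\in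 E\to\exists n\exists x(p=(n,x)\wedge n\in\omega\wedge x\in\mathbf U))$, * $\forall n(n\in\omega\to\exists x\,(n,x)\in E)$, * $\forall n\forall x\forall y((n,x)\in E\wedge(n,y)\in E\to x=y)$, * $\forall m\forall n\forall x((m,x)\in E\wedge(n,x)\in E\to m=n)$, * $\forall x(x\in\mathbf U\to\exists n(n\in\omega\wedge(n,x)\in E))$ is a maxim. Consequently it is a maxim that there is a bijection from $\omega$ onto $\mathbf U$: the universe is countable. -/

import Mathlib

namespace Librationism

/-! ## The language -/

mutual
/-- Terms: variables, the primitive constants `𝒯` and `ℱ`, the set abstracts `{vₙ | A}`, and the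
names `⌜a⌝`, `⌜A⌝` of terms and formulas. -/
inductive Tm : Type
  | var : ℕ → Tm
  | truth : Tm
  | fls : Tm
  | abs : ℕ → Fm → Tm
  | nameT : Tm → Tm
  | nameF : Fm → Tm
/-- Formulas: the apposition `b a` of two terms (read `a ∈ b`), joint denial, universal
quantification, and the well-ordering `a ⊴ b`. -/
inductive Fm : Type
  | app : Tm → Tm → Fm
  | nor : Fm → Fm → Fm
  | all : ℕ → Fm → Fm
  | le : Tm → Tm → Fm
end

/- Names are transparent: the variables that are free in an expression are free in its name. -/
mutual
/-- The free variables of a term. -/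
def Tm.fv : Tm → Finset ℕ
  | .var n => {n}
  | .truth => ∅
  | .fls => ∅
  | .abs n A => A.fv.erase n
  | .nameT a => a.fv
  | .nameF A => A.fv
/-- The free variables of a formula. -/
def Fm.fv : Fm → Finset ℕ
  | .app b a => b.fv ∪ a.fv
  | .nor A B => A.fv ∪ B.fv
  | .all n A => A.fv.erase n
  | .le a b => a.fv ∪ b.fv
end

/-- A constant is a term without free variables. -/
def Tm.IsConstant (a : Tm) : Prop := a.fv = ∅

/-- A sentence is a formula without free variables. -/
def Fm.IsSentence (A : Fm) : Prop := A.fv = ∅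

mutual
/-- `a.subst v t` is the term `a` with `t` put for the free occurrences of the variable `v`. -/
def Tm.subst : Tm → ℕ → Tm → Tm
  | .var n, v, t => if n = v then t else .var n
  | .truth, _, _ => .truth
  | .fls, _, _ => .fls
  | .abs n A, v, t => if n = v then .abs n A else .abs n (A.subst v t)
  | .nameT a, v, t => .nameT (a.subst v t)
  | .nameF A, v, t => .nameF (A.subst v t)
/-- `A.subst v t` is the formula `A` with `t` put for the free occurrences of the variable `v`. -/
def Fm.subst : Fm → ℕ → Tm → Fm
  | .app b a, v, t => .app (b.subst v t) (a.subst v t)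
  | .nor A B, v, t => .nor (A.subst v t) (B.subst v t)
  | .all n A, v, t => if n = v then .all n A else .all n (A.subst v t)
  | .le a b, v, t => .le (a.subst v t) (b.subst v t)
end

/-- The logical depth of a formula. -/
def Fm.depth : Fm → ℕ
  | .app _ _ => 0
  | .nor A B => max A.depth B.depth + 1
  | .all _ A => A.depth + 1
  | .le _ _ => 0

theorem Fm.depth_subst (v : ℕ) (t : Tm) : ∀ A : Fm, (A.subst v t).depth = A.depth
  | .app _ _ => by simp [Fm.subst, Fm.depth]
  | .nor A B => by simp [Fm.subst, Fm.depth, Fm.depth_subst v t A, Fm.depth_subst v t B]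
  | .all n A => by
      by_cases h : n = v <;> simp [Fm.subst, Fm.depth, h, Fm.depth_subst v t A]
  | .le _ _ => by simp [Fm.subst, Fm.depth]

/-! ## Chiffers: expressions as natural numbers -/

mutual
/-- The Polish symbol string of a term; the symbols `•`, `v̈`, `↓`, `∀`, `ς`, `#`, `𝒯`, `ℱ` and
`⊴` are the digits from `1` to `9`, and `10` marks an apposition. -/
def Tm.symbols : Tm → List ℕ
  | .var n => 2 :: List.replicate n 1
  | .truth => [7]
  | .fls => [8]
  | .abs n A => 5 :: 2 :: (List.replicate n 1 ++ A.symbols)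
  | .nameT a => 6 :: a.symbols
  | .nameF A => 6 :: A.symbols
/-- The Polish symbol string of a formula. -/
def Fm.symbols : Fm → List ℕ
  | .app b a => 10 :: (b.symbols ++ a.symbols)
  | .nor A B => 3 :: (A.symbols ++ B.symbols)
  | .all n A => 4 :: 2 :: (List.replicate n 1 ++ A.symbols)
  | .le a b => 9 :: (a.symbols ++ b.symbols)
end

/-- The natural number denoted by the symbol string, as a bijective base-10 numeral. -/
def Tm.chiffer (a : Tm) : ℕ := a.symbols.foldl (fun n d => 10 * n + d) 0

/-! ## Barters -/

/-- `x = a` according to the membership relation `mem` (`mem u a` says that `a ∈ u`):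
`a` is in every set that has `x` as a member. -/
def Coessential (mem : Tm → Tm → Prop) (x a : Tm) : Prop :=
  ∀ u : Tm, u.IsConstant → mem u x → mem u a

/-- The least chiffer of a constant that is identical with `a`. -/
noncomputable def leastChiffer (mem : Tm → Tm → Prop) (a : Tm) : ℕ :=
  sInf {n | ∃ x : Tm, x.IsConstant ∧ x.chiffer = n ∧ n ≤ a.chiffer ∧ Coessential mem x a}

/-- The set of sentences that the membership relation `mem` between constants settles: it is
closed under the clauses for joint denial and for quantification over all constants, and `⊴`
compares least chiffers. -/
def Holds (mem : Tm → Tm → Prop) : Fm → Prop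
  | .app b a => mem b a
  | .nor A B => ¬ Holds mem A ∧ ¬ Holds mem B
  | .all v A => ∀ t : Tm, t.IsConstant → Holds mem (A.subst v t)
  | .le a b => leastChiffer mem a ≤ leastChiffer mem b
termination_by A => A.depth
decreasing_by
  · simp only [Fm.depth]; omega
  · simp only [Fm.depth]; omega
  · simp only [Fm.depth, Fm.depth_subst]; omega

/-- A barber: for each natural chiffer `n` the atomic sentences `b a` that hold initially,
and for each later ordinal those that hold among the atomic sentences which neither the clause
for set abstracts nor the clause for truth settles. -/
structure Barber where
  /-- the memberships at ordinal zero -/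
  start : ℕ → Tm → Tm → Prop
  /-- the memberships that are left open at later ordinals -/
  rest : ℕ → Ordinal.{0} → Tm → Tm → Prop

/-- The memberships of the barter on `n` at `α`. For `α > 0`, `t ∈ {v | A}` holds if the sentence
got by putting `t` for `v` in `A` holds at all ordinals from some ordinal below `α` up to `α`, and
`𝒯⌜A⌝` holds if `A` does so. -/
noncomputable def Barber.mem (𝔅 : Barber) (n : ℕ) (α : Ordinal.{0}) : Tm → Tm → Prop := fun u t =>
  if α = 0 then 𝔅.start n u t
  else
    match u, t with
    | .abs v A, t =>
        ∃ γ < α, ∀ δ, γ ≤ δ → ∀ _ : δ < α, Holds (𝔅.mem n δ) (A.subst v t)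
    | .truth, .nameF A =>
        ∃ γ < α, ∀ δ, γ ≤ δ → ∀ _ : δ < α, Holds (𝔅.mem n δ) A
    | u, t => 𝔅.rest n α u t
termination_by α

/-- `⊨ₙ^α A`. -/
def Barber.Sat (𝔅 : Barber) (n : ℕ) (α : Ordinal.{0}) (A : Fm) : Prop := Holds (𝔅.mem n α) A

/-- `⊨^α A`. -/
def Barber.SatAll (𝔅 : Barber) (α : Ordinal.{0}) (A : Fm) : Prop := ∀ n, 𝔅.Sat n α A

/-! ## Defined operators of the object language -/

/-- `𝒯⌜A⌝` -/
def tr (A : Fm) : Fm := .app .truth (.nameF A)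
/-- `¬ A` -/
def neg (A : Fm) : Fm := .nor A A
/-- `A ∧ B` -/
def conj (A B : Fm) : Fm := .nor (neg A) (neg B)
/-- `A ∨ B` -/
def disj (A B : Fm) : Fm := neg (.nor A B)
/-- `A → B` -/
def imp (A B : Fm) : Fm := disj (neg A) B
/-- `∃ vₙ A` -/
def ex (n : ℕ) (A : Fm) : Fm := neg (.all n (neg A))
/-- `a ∈ b` -/
def isIn (a b : Tm) : Fm := .app b a

/-! ## Closure ordinal, maxims, optima, orthodoxy -/

/-- `IN^α(A)` -/
def Barber.InFrom (𝔅 : Barber) (α : Ordinal.{0}) (A : Fm) : Prop :=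
  ∀ β, α ≤ β → 𝔅.SatAll β (tr A)

/-- `IN(A)` -/
def Barber.In (𝔅 : Barber) (A : Fm) : Prop := ∃ α, 𝔅.InFrom α A

/-- `α` covers `A`. -/
def Barber.Covers (𝔅 : Barber) (α : Ordinal.{0}) (A : Fm) : Prop := 𝔅.In A → 𝔅.InFrom α A

/-- `α` stabilizes `A`. -/
def Barber.Stabilizes (𝔅 : Barber) (α : Ordinal.{0}) (A : Fm) : Prop :=
  𝔅.Covers α A ∧ (𝔅.SatAll α (tr A) → 𝔅.In A)

/-- The closure ordinal: the least ordinal that stabilizes all sentences. -/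
noncomputable def Barber.closure (𝔅 : Barber) : Ordinal.{0} :=
  sInf {α | ∀ A : Fm, A.IsSentence → 𝔅.Stabilizes α A}

/-- `A` is a maxim. -/
def Barber.Maxim (𝔅 : Barber) (A : Fm) : Prop := ∀ n, 𝔅.Sat n 𝔅.closure (tr A)

/-- `A` is an optimum. -/
def Barber.Optimum (𝔅 : Barber) (A : Fm) : Prop := ∀ n, 𝔅.Sat n 𝔅.closure A

/-- The set `a` (a constant) is orthodox. -/
def Barber.OrthodoxSet (𝔅 : Barber) (a : Tm) : Prop :=
  𝔅.Optimum (.all 0 (disj (tr (isIn (.var 0) a)) (tr (neg (isIn (.var 0) a)))))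

/-! ## Sets

Every operator below binds variables of its own, with an index of at least `100`, which must not be
free in its arguments. -/

/-- `a = b`, that is `∀ u (a ∈ u → b ∈ u)` -/
def eqn (a b : Tm) : Fm := .all 100 (imp (isIn a (.var 100)) (isIn b (.var 100)))

/-- `{a, b}` -/
def upair (a b : Tm) : Tm := .abs 101 (disj (eqn (.var 101) a) (eqn (.var 101) b))

/-- the Kuratowski pair `⟨a, b⟩ = {{a}, {a, b}}`, where `{a} = {a, a}` -/
def pair (a b : Tm) : Tm := upair (upair a a) (upair a b)

/-- `{(vᵢ, vⱼ) | A}` -/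
def pairAbs (i j : ℕ) (A : Fm) : Tm :=
  .abs 109 (ex i (ex j (conj (eqn (.var 109) (pair (.var i) (.var j))) A)))

/-- the empty set `{x | x ≠ x}` -/
def empty : Tm := .abs 103 (neg (eqn (.var 103) (.var 103)))

/-- the successor `a' = {x | x = a ∨ x ∈ a}` -/
def succ (a : Tm) : Tm := .abs 102 (disj (eqn (.var 102) a) (isIn (.var 102) a))

/-- `ω = {x | ∀ y (∅ ∈ y ∧ ∀ z (z ∈ y → z' ∈ y) → x ∈ y)}` -/
def omega : Tm :=
  .abs 104 (.all 105 (imp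
    (conj (isIn empty (.var 105))
      (.all 106 (imp (isIn (.var 106) (.var 105)) (isIn (succ (.var 106)) (.var 105)))))
    (isIn (.var 104) (.var 105))))

/-- the universal set `U = {x | x = x}` -/
def univSet : Tm := .abs 107 (eqn (.var 107) (.var 107))

/-- `a \ b = {x | x ∈ a ∧ x ∉ b}` -/
def diff (a b : Tm) : Tm := .abs 108 (conj (isIn (.var 108) a) (neg (isIn (.var 108) b)))

/-- The function `f` has the value `b` at `a`:
`∀ x ∀ y ∀ z (⟨x, y⟩ ∈ f ∧ ⟨x, z⟩ ∈ f → y = z) ∧ ⟨a, b⟩ ∈ f` -/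
def valueIs (f a b : Tm) : Fm :=
  conj
    (.all 113 (.all 114 (.all 115 (imp
      (conj (isIn (pair (.var 113) (.var 114)) f) (isIn (pair (.var 113) (.var 115)) f))
      (eqn (.var 114) (.var 115))))))
    (isIn (pair a b) f)

/-- `x` is a member of the value of `f` at `a`: `∃ y (f has the value y at a ∧ x ∈ y)` -/
def memValue (x f a : Tm) : Fm := ex 116 (conj (valueIs f a (.var 116)) (isIn x (.var 116)))

/-- the manifestation set of `A(y, z)`: `{w | ⟨w, 𝐚⟩ ∈ 𝐚}`, where
`𝐚 = {(y, z) | A(y, {w | ⟨w, z⟩ ∈ z})}` -/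
def manifestation (A : Tm → Tm → Fm) : Tm :=
  let diag : Tm → Tm := fun z => .abs 112 (isIn (pair (.var 112) z) z)
  diag (pairAbs 110 111 (A (.var 110) (diag (.var 111))))

/-! ## The choice function and the enumerator -/

/-- `{x | x ∈ w ∧ ∀ y (y ∈ w → x ⊴ y)}` -/
def firstOf (w : Tm) : Tm :=
  .abs 117 (conj (isIn (.var 117) w)
    (.all 118 (imp (isIn (.var 118) w) (.le (.var 117) (.var 118)))))

/-- The choice function `𝒮`, whose value at `w` is `{x | x ∈ w ∧ ∀ y (y ∈ w → x ⊴ y)}`. -/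
def choice : Tm := pairAbs 119 120 (eqn (.var 120) (firstOf (.var 119)))

/-- The iterated choices from the constant `b`: the function `h` with value `𝒮ᵐ b` at `m`, that is,
`h` has at `m` the value `a` just if `m = 0` and `𝒮` has the value `a` at `b`, or, for some
`n ∈ ω`, `m = n + 1` and `𝒮` has the value `a` at `b \ ⋃ {𝒮ⁱ b | i ≤ n}`. The recursion is
solved by a manifestation set. -/
def iteratedChoice (b : Tm) : Tm :=
  manifestation fun p h =>
    ex 121 (ex 122 (conj (eqn p (pair (.var 121) (.var 122)))
      (disj
        (conj (eqn (.var 121) empty) (valueIs choice b (.var 122)))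
        (ex 123 (conj (isIn (.var 123) omega)
          (conj (eqn (.var 121) (succ (.var 123)))
            (valueIs choice
              (diff b (.abs 125 (ex 124 (conj (isIn (.var 124) (succ (.var 123)))
                (memValue (.var 125) h (.var 124))))))
              (.var 122))))))))

/-- The enumerator `{(n, x) | n ∈ ω ∧ x ∈ 𝒮ⁿ U}`. -/
def enumerator : Tm :=
  pairAbs 126 127 (conj (isIn (.var 126) omega)
    (memValue (.var 127) (iteratedChoice univSet) (.var 126)))

/-- `f` is a bijection from `a` to `b`: it is a set of pairs of a member of `a` and a member of
`b`, total on `a`, functional, injective, and onto `b`. -/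
def bijection (f a b : Tm) : Fm :=
  conj
    (.all 128 (imp (isIn (.var 128) f)
      (ex 129 (ex 130 (conj (eqn (.var 128) (pair (.var 129) (.var 130)))
        (conj (isIn (.var 129) a) (isIn (.var 130) b)))))))
    (conj
      (.all 129 (imp (isIn (.var 129) a) (ex 130 (isIn (pair (.var 129) (.var 130)) f))))
      (conj
        (.all 129 (.all 130 (.all 131 (imp
          (conj (isIn (pair (.var 129) (.var 130)) f) (isIn (pair (.var 129) (.var 131)) f))
          (eqn (.var 130) (.var 131))))))
        (conj
          (.all 129 (.all 130 (.all 131 (imp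
            (conj (isIn (pair (.var 129) (.var 131)) f) (isIn (pair (.var 130) (.var 131)) f))
            (eqn (.var 129) (.var 130))))))
          (.all 130 (imp (isIn (.var 130) b)
            (ex 129 (conj (isIn (.var 129) a) (isIn (pair (.var 129) (.var 130)) f))))))))

end Librationism

/-!
The barter on each `n` is studied through the truth values that are eventually constant: `A` decides
`P` (`Decides`) if from some stage on `A` holds just if `P` does. Eventual truth values commute with
the connectives, with quantification over all constants (a family of stages that is indexed by the
constants is bounded), with abstraction and with `𝒯`; so on the sentences that have one, the
revision process behaves like a classical model.

Identity always has an eventual truth value. Once `a = b` fails at a stage it fails ever after,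
since `{x | a = x}` separates `a` from `b` (`not_sat_eqn_of_lt`). Hence from some stage on the
identities are those that hold at all stages (`Eqv`), and these satisfy Leibniz's law for all terms
and formulas (`Eqv.sat_iff`, `Eqv.congr_subst`). Pairs, numerals and the ordering `⊴` are then
settled as well; since chiffers are uniquely readable, `⊴` is eventually a linear ordering of the
constants up to identity, in the order type of the natural numbers (`rank_eq_iff`,
`infinite_isRank`).

The delicate point is that `ω` has no nonstandard members (`decides_mem_omega`), as its defining
quantifier ranges over constants and there need not be a set that consists of just the numerals at
all stages. But a paradoxical sentence tells limit stages from successor stages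
(`limitSentence`), and a manifestation set that is emptied after each limit and then collects
numerals one by one consists of exactly the numerals at the next limit (`counter`). From then on
`ω` is standard, because `ω` is itself inductive and so can never gain members.

The recursion for the iterated choices takes place inside of a term, so that the value of the
function at the numeral of `k` is a fixed constant (`iterate`), and by induction on `k` its members
are just the constants of the `k`-th rank (`decides_mem_iterate`). The enumerator therefore relates
the `k`-th numeral to the constants of the `k`-th rank, and all claims about it can be read off.

Finally, a sentence that eventually holds in all barters is a maxim and an optimum
(`maxim_of_in`, `optimum_of_in`), provided that there is a stabilizing ordinal at all; one is the
limit of a sequence of stages that leaves each sentence the time to fail if it ever does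
(`exists_stabilizes`).
-/

namespace Librationism

/-! ### Substitution and free variables -/

mutual
theorem Tm.subst_of_notMem : ∀ (a : Tm) {v : ℕ} {t : Tm}, v ∉ a.fv → a.subst v t = a
  | .var n, v, t, h => by
      have : n ≠ v := fun e => h (by simp [Tm.fv, e])
      simp [Tm.subst, this]
  | .truth, _, _, _ => rfl
  | .fls, _, _, _ => rfl
  | .abs n A, v, t, h => by
      by_cases e : n = v
      · simp [Tm.subst, e]
      · simp [Tm.subst, e, Fm.subst_of_notMem A (v := v) (t := t)
          (fun h' => h (by simp [Tm.fv, h', Ne.symm e]))]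
  | .nameT a, v, t, h => by
      simp [Tm.subst, Tm.subst_of_notMem a (v := v) (t := t) (by simpa [Tm.fv] using h)]
  | .nameF A, v, t, h => by
      simp [Tm.subst, Fm.subst_of_notMem A (v := v) (t := t) (by simpa [Tm.fv] using h)]
theorem Fm.subst_of_notMem : ∀ (A : Fm) {v : ℕ} {t : Tm}, v ∉ A.fv → A.subst v t = A
  | .app b a, v, t, h => by
      simp only [Fm.fv, Finset.mem_union, not_or] at h
      simp [Fm.subst, Tm.subst_of_notMem b h.1, Tm.subst_of_notMem a h.2]
  | .nor A B, v, t, h => by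
      simp only [Fm.fv, Finset.mem_union, not_or] at h
      simp [Fm.subst, Fm.subst_of_notMem A h.1, Fm.subst_of_notMem B h.2]
  | .all n A, v, t, h => by
      by_cases e : n = v
      · simp [Fm.subst, e]
      · simp [Fm.subst, e, Fm.subst_of_notMem A (v := v) (t := t)
          (fun h' => h (by simp [Fm.fv, h', Ne.symm e]))]
  | .le a b, v, t, h => by
      simp only [Fm.fv, Finset.mem_union, not_or] at h
      simp [Fm.subst, Tm.subst_of_notMem b h.2, Tm.subst_of_notMem a h.1]
end

theorem Tm.IsConstant.subst {a : Tm} (h : a.IsConstant) (v : ℕ) (t : Tm) : a.subst v t = a :=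
  a.subst_of_notMem (by simp [show a.fv = ∅ from h])

theorem Fm.IsSentence.subst {A : Fm} (h : A.IsSentence) (v : ℕ) (t : Tm) : A.subst v t = A :=
  A.subst_of_notMem (by simp [show A.fv = ∅ from h])

mutual
theorem Tm.fv_subst {t : Tm} (ht : t.IsConstant) (v : ℕ) :
    ∀ a : Tm, (a.subst v t).fv = a.fv.erase v
  | .var n => by
      by_cases e : n = v
      · simpa [Tm.subst, Tm.fv, e] using (show t.fv = ∅ from ht)
      · simp [Tm.subst, Tm.fv, e, Ne.symm e]
  | .truth => by simp [Tm.subst, Tm.fv]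
  | .fls => by simp [Tm.subst, Tm.fv]
  | .abs n A => by
      by_cases e : n = v
      · simp [Tm.subst, Tm.fv, e]
      · simp [Tm.subst, Tm.fv, e, Fm.fv_subst ht v A, Finset.erase_right_comm]
  | .nameT a => by simp [Tm.subst, Tm.fv, Tm.fv_subst ht v a]
  | .nameF A => by simp [Tm.subst, Tm.fv, Fm.fv_subst ht v A]
theorem Fm.fv_subst {t : Tm} (ht : t.IsConstant) (v : ℕ) :
    ∀ A : Fm, (A.subst v t).fv = A.fv.erase v
  | .app b a => by
      simp [Fm.subst, Fm.fv, Tm.fv_subst ht v a, Tm.fv_subst ht v b, Finset.erase_union_distrib]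
  | .nor A B => by
      simp [Fm.subst, Fm.fv, Fm.fv_subst ht v A, Fm.fv_subst ht v B, Finset.erase_union_distrib]
  | .all n A => by
      by_cases e : n = v
      · simp [Fm.subst, Fm.fv, e]
      · simp [Fm.subst, Fm.fv, e, Fm.fv_subst ht v A, Finset.erase_right_comm]
  | .le a b => by
      simp [Fm.subst, Fm.fv, Tm.fv_subst ht v a, Tm.fv_subst ht v b, Finset.erase_union_distrib]
end

mutual
theorem Tm.subst_comm {s t : Tm} (hs : s.IsConstant) (ht : t.IsConstant) {i j : ℕ} (hij : i ≠ j) :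
    ∀ a : Tm, (a.subst i s).subst j t = (a.subst j t).subst i s
  | .var n => by
      by_cases e : n = i
      · simp [Tm.subst, e, hij, hs.subst]
      · by_cases e' : n = j
        · simp [Tm.subst, e', hij.symm, ht.subst]
        · simp [Tm.subst, e, e']
  | .truth => rfl
  | .fls => rfl
  | .abs n A => by
      rcases eq_or_ne n i with rfl | e
      · simp [Tm.subst, hij]
      · rcases eq_or_ne n j with rfl | e'
        · simp [Tm.subst, e]
        · simp [Tm.subst, e, e', Fm.subst_comm hs ht hij A]
  | .nameT a => by simp [Tm.subst, Tm.subst_comm hs ht hij a]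
  | .nameF A => by simp [Tm.subst, Fm.subst_comm hs ht hij A]
theorem Fm.subst_comm {s t : Tm} (hs : s.IsConstant) (ht : t.IsConstant) {i j : ℕ} (hij : i ≠ j) :
    ∀ A : Fm, (A.subst i s).subst j t = (A.subst j t).subst i s
  | .app b a => by simp [Fm.subst, Tm.subst_comm hs ht hij a, Tm.subst_comm hs ht hij b]
  | .nor A B => by simp [Fm.subst, Fm.subst_comm hs ht hij A, Fm.subst_comm hs ht hij B]
  | .all n A => by
      rcases eq_or_ne n i with rfl | e
      · simp [Fm.subst, hij]
      · rcases eq_or_ne n j with rfl | e'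
        · simp [Fm.subst, e]
        · simp [Fm.subst, e, e', Fm.subst_comm hs ht hij A]
  | .le a b => by simp [Fm.subst, Tm.subst_comm hs ht hij a, Tm.subst_comm hs ht hij b]
end

/-! ### Unique readability -/

mutual
theorem Tm.symbols_digits : ∀ (a : Tm), ∀ d ∈ a.symbols, 1 ≤ d ∧ d ≤ 10
  | .var n => by
      simp only [Tm.symbols, List.mem_cons, List.mem_replicate]
      omega
  | .truth => by simp [Tm.symbols]
  | .fls => by simp [Tm.symbols]
  | .abs n A => by
      have := Fm.symbols_digits A
      simp only [Tm.symbols, List.mem_cons, List.mem_append, List.mem_replicate]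
      rintro d (h | h | h | h) <;> first | exact this d h | omega
  | .nameT a => by
      have := Tm.symbols_digits a
      simp only [Tm.symbols, List.mem_cons]
      rintro d (h | h) <;> first | exact this d h | omega
  | .nameF A => by
      have := Fm.symbols_digits A
      simp only [Tm.symbols, List.mem_cons]
      rintro d (h | h) <;> first | exact this d h | omega
theorem Fm.symbols_digits : ∀ (A : Fm), ∀ d ∈ A.symbols, 1 ≤ d ∧ d ≤ 10
  | .app b a => by
      have h1 := Tm.symbols_digits b
      have h2 := Tm.symbols_digits a
      simp only [Fm.symbols, List.mem_cons, List.mem_append]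
      rintro d (h | h | h) <;> first | exact h1 d h | exact h2 d h | omega
  | .nor A B => by
      have h1 := Fm.symbols_digits A
      have h2 := Fm.symbols_digits B
      simp only [Fm.symbols, List.mem_cons, List.mem_append]
      rintro d (h | h | h) <;> first | exact h1 d h | exact h2 d h | omega
  | .all n A => by
      have := Fm.symbols_digits A
      simp only [Fm.symbols, List.mem_cons, List.mem_append, List.mem_replicate]
      rintro d (h | h | h | h) <;> first | exact this d h | omega
  | .le a b => by
      have h1 := Tm.symbols_digits a
      have h2 := Tm.symbols_digits b
      simp only [Fm.symbols, List.mem_cons, List.mem_append]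
      rintro d (h | h | h) <;> first | exact h1 d h | exact h2 d h | omega
end

theorem foldl_digits_injective (l : List ℕ) : ∀ l' : List ℕ,
    (∀ d ∈ l, 1 ≤ d ∧ d ≤ 10) → (∀ d ∈ l', 1 ≤ d ∧ d ≤ 10) →
    l.foldl (fun n d => 10 * n + d) 0 = l'.foldl (fun n d => 10 * n + d) 0 → l = l' := by
  induction l using List.reverseRecOn with
  | nil =>
      intro l' _ h' e
      induction l' using List.reverseRecOn with
      | nil => rfl
      | append_singleton l' d _ =>
          have := h' d (by simp)
          simp at e
          omega
  | append_singleton l d ih =>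
      intro l' h h' e
      have hd := h d (by simp)
      induction l' using List.reverseRecOn with
      | nil =>
          simp at e
          omega
      | append_singleton l' d' _ =>
          have hd' := h' d' (by simp)
          simp only [List.foldl_append, List.foldl_cons, List.foldl_nil] at e
          have e' : d = d' := by omega
          subst e'
          rw [ih l' (fun x hx => h x (by simp [hx])) (fun x hx => h' x (by simp [hx])) (by omega)]

theorem Tm.symbols_head (a : Tm) : ∃ d l, a.symbols = d :: l ∧ d ∈ ([2, 7, 8, 5, 6] : List ℕ) := by
  cases a <;> simp [Tm.symbols]

theorem Fm.symbols_head (A : Fm) : ∃ d l, A.symbols = d :: l ∧ d ∈ ([10, 3, 4, 9] : List ℕ) := by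
  cases A <;> simp [Fm.symbols]

theorem Tm.head_symbols_append (a : Tm) (l : List ℕ) : (a.symbols ++ l).head? ≠ some 1 := by
  obtain ⟨d, l', e, hd⟩ := a.symbols_head
  rw [e]
  rintro h
  simp at h
  simp [h] at hd

theorem Fm.head_symbols_append (A : Fm) (l : List ℕ) : (A.symbols ++ l).head? ≠ some 1 := by
  obtain ⟨d, l', e, hd⟩ := A.symbols_head
  rw [e]
  rintro h
  simp at h
  simp [h] at hd

theorem Tm.symbols_ne (a : Tm) (A : Fm) (l l' : List ℕ) : a.symbols ++ l ≠ A.symbols ++ l' := by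
  obtain ⟨d, k, e, hd⟩ := a.symbols_head
  obtain ⟨d', k', e', hd'⟩ := A.symbols_head
  rw [e, e']
  intro h
  simp at h
  simp at hd hd'
  omega

theorem replicate_append_injective : ∀ (m n : ℕ) {l l' : List ℕ}, l.head? ≠ some 1 →
    l'.head? ≠ some 1 → List.replicate m 1 ++ l = List.replicate n 1 ++ l' → m = n ∧ l = l'
  | 0, 0, l, l', _, _, e => by simpa using e
  | 0, n + 1, l, l', h, _, e => by
      simp [List.replicate_succ] at e
      simp [e] at h
  | m + 1, 0, l, l', _, h, e => by
      simp [List.replicate_succ] at e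
      simp [← e] at h
  | m + 1, n + 1, l, l', h, h', e => by
      have := replicate_append_injective m n h h' (by simpa [List.replicate_succ] using e)
      simpa using this

/- An expression can be a proper prefix of another only because its last variable may be continued
by the symbol `1`; hence the hypotheses on the first symbol of what follows. -/
mutual
theorem Tm.symbols_append_injective : ∀ (a b : Tm) {l l' : List ℕ}, l.head? ≠ some 1 →
    l'.head? ≠ some 1 → a.symbols ++ l = b.symbols ++ l' → a = b ∧ l = l'
  | .var m, b, l, l', h, h', e => by
      cases b <;> simp [Tm.symbols] at e
      simpa using replicate_append_injective _ _ h h' e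
  | .truth, b, l, l', h, h', e => by
      cases b <;> simp [Tm.symbols] at e
      simpa using e
  | .fls, b, l, l', h, h', e => by
      cases b <;> simp [Tm.symbols] at e
      simpa using e
  | .abs m A, b, l, l', h, h', e => by
      cases b <;> simp [Tm.symbols] at e
      obtain ⟨rfl, e'⟩ := replicate_append_injective _ _ (A.head_symbols_append _)
        (Fm.head_symbols_append _ _) e
      simpa using Fm.symbols_append_injective A _ h h' e'
  | .nameT a, b, l, l', h, h', e => by
      cases b <;> simp [Tm.symbols] at e
      · simpa using Tm.symbols_append_injective a _ h h' e
      · exact absurd e (Tm.symbols_ne _ _ _ _)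
  | .nameF A, b, l, l', h, h', e => by
      cases b <;> simp [Tm.symbols] at e
      · exact absurd e.symm (Tm.symbols_ne _ _ _ _)
      · simpa using Fm.symbols_append_injective A _ h h' e
theorem Fm.symbols_append_injective : ∀ (A B : Fm) {l l' : List ℕ}, l.head? ≠ some 1 →
    l'.head? ≠ some 1 → A.symbols ++ l = B.symbols ++ l' → A = B ∧ l = l'
  | .app b a, B, l, l', h, h', e => by
      cases B <;> simp [Fm.symbols] at e
      obtain ⟨rfl, e'⟩ := Tm.symbols_append_injective b _ (a.head_symbols_append _)
        (Tm.head_symbols_append _ _) e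
      simpa using Tm.symbols_append_injective a _ h h' e'
  | .nor A A', B, l, l', h, h', e => by
      cases B <;> simp [Fm.symbols] at e
      obtain ⟨rfl, e'⟩ := Fm.symbols_append_injective A _ (A'.head_symbols_append _)
        (Fm.head_symbols_append _ _) e
      simpa using Fm.symbols_append_injective A' _ h h' e'
  | .all m A, B, l, l', h, h', e => by
      cases B <;> simp [Fm.symbols] at e
      obtain ⟨rfl, e'⟩ := replicate_append_injective _ _ (A.head_symbols_append _)
        (Fm.head_symbols_append _ _) e
      simpa using Fm.symbols_append_injective A _ h h' e'
  | .le a b, B, l, l', h, h', e => by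
      cases B <;> simp [Fm.symbols] at e
      obtain ⟨rfl, e'⟩ := Tm.symbols_append_injective a _ (b.head_symbols_append _)
        (Tm.head_symbols_append _ _) e
      simpa using Tm.symbols_append_injective b _ h h' e'
end

theorem Tm.chiffer_injective : Function.Injective Tm.chiffer := by
  intro a b e
  have := foldl_digits_injective _ _ a.symbols_digits b.symbols_digits e
  exact (Tm.symbols_append_injective a b (l := []) (l' := []) (by simp) (by simp) (by simpa)).1


/-! ### Syntax of the defined operators -/

section Substitution
variable (v : ℕ) (t : Tm) (A B : Fm) (a b c : Tm)

@[simp] theorem subst_tr : (tr A).subst v t = tr (A.subst v t) := by simp [tr, Fm.subst, Tm.subst]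
@[simp] theorem subst_neg : (neg A).subst v t = neg (A.subst v t) := by simp [neg, Fm.subst]
@[simp] theorem subst_conj : (conj A B).subst v t = conj (A.subst v t) (B.subst v t) := by
  simp [conj, Fm.subst]
@[simp] theorem subst_disj : (disj A B).subst v t = disj (A.subst v t) (B.subst v t) := by
  simp [disj, Fm.subst]
@[simp] theorem subst_imp : (imp A B).subst v t = imp (A.subst v t) (B.subst v t) := by
  simp [imp]
@[simp] theorem subst_isIn : (isIn a b).subst v t = isIn (a.subst v t) (b.subst v t) := by
  simp [isIn, Fm.subst]
@[simp] theorem subst_le : (Fm.le a b).subst v t = .le (a.subst v t) (b.subst v t) := by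
  simp [Fm.subst]
@[simp] theorem subst_var_self : (Tm.var v).subst v t = t := by simp [Tm.subst]

variable {v}

theorem subst_var_ne {n : ℕ} (h : n ≠ v) : (Tm.var n).subst v t = .var n := by simp [Tm.subst, h]
theorem subst_abs {n : ℕ} (h : n ≠ v) : (Tm.abs n A).subst v t = .abs n (A.subst v t) := by
  simp [Tm.subst, h]
theorem subst_all {n : ℕ} (h : n ≠ v) : (Fm.all n A).subst v t = .all n (A.subst v t) := by
  simp [Fm.subst, h]
theorem subst_ex {n : ℕ} (h : n ≠ v) : (ex n A).subst v t = ex n (A.subst v t) := by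
  simp [ex, subst_all, h]
theorem subst_eqn (h : 100 ≠ v) : (eqn a b).subst v t = eqn (a.subst v t) (b.subst v t) := by
  simp [eqn, subst_all, subst_var_ne, h]
theorem subst_upair (h : 100 ≠ v) (h' : 101 ≠ v) :
    (upair a b).subst v t = upair (a.subst v t) (b.subst v t) := by
  simp [upair, subst_abs, subst_var_ne, subst_eqn, h, h']
theorem subst_pair (h : 100 ≠ v) (h' : 101 ≠ v) :
    (pair a b).subst v t = pair (a.subst v t) (b.subst v t) := by
  simp [pair, subst_upair, h, h']
theorem subst_succ (h : 100 ≠ v) (h' : 102 ≠ v) : (succ a).subst v t = succ (a.subst v t) := by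
  simp [succ, subst_abs, subst_var_ne, subst_eqn, h, h']
theorem subst_diff (h : 108 ≠ v) : (diff a b).subst v t = diff (a.subst v t) (b.subst v t) := by
  simp [diff, subst_abs, subst_var_ne, h]
theorem subst_valueIs (h100 : 100 ≠ v) (h101 : 101 ≠ v) (h113 : 113 ≠ v) (h114 : 114 ≠ v)
    (h115 : 115 ≠ v) :
    (valueIs a b c).subst v t = valueIs (a.subst v t) (b.subst v t) (c.subst v t) := by
  simp [valueIs, subst_all, subst_var_ne, subst_eqn, subst_pair, *]
theorem subst_memValue (h100 : 100 ≠ v) (h101 : 101 ≠ v) (h113 : 113 ≠ v) (h114 : 114 ≠ v)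
    (h115 : 115 ≠ v) (h116 : 116 ≠ v) :
    (memValue a b c).subst v t = memValue (a.subst v t) (b.subst v t) (c.subst v t) := by
  simp [memValue, subst_ex, subst_var_ne, subst_valueIs, *]
theorem subst_firstOf (h117 : 117 ≠ v) (h118 : 118 ≠ v) :
    (firstOf a).subst v t = firstOf (a.subst v t) := by
  simp [firstOf, subst_all, subst_abs, subst_var_ne, *]

end Substitution

section FreeVariables

@[simp] theorem fv_tr (A : Fm) : (tr A).fv = A.fv := by simp [tr, Fm.fv, Tm.fv]
@[simp] theorem fv_neg (A : Fm) : (neg A).fv = A.fv := by simp [neg, Fm.fv]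
@[simp] theorem fv_conj (A B : Fm) : (conj A B).fv = A.fv ∪ B.fv := by simp [conj, Fm.fv]
@[simp] theorem fv_disj (A B : Fm) : (disj A B).fv = A.fv ∪ B.fv := by simp [disj, Fm.fv]
@[simp] theorem fv_imp (A B : Fm) : (imp A B).fv = A.fv ∪ B.fv := by simp [imp]
@[simp] theorem fv_isIn (a b : Tm) : (isIn a b).fv = a.fv ∪ b.fv := by
  simp [isIn, Fm.fv, Finset.union_comm]
@[simp] theorem fv_ex (n : ℕ) (A : Fm) : (ex n A).fv = A.fv.erase n := by simp [ex, Fm.fv]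

attribute [simp] Tm.fv Fm.fv

theorem Tm.isConstant_iff {a : Tm} : a.IsConstant ↔ ∀ v, v ∉ a.fv :=
  Finset.eq_empty_iff_forall_notMem

theorem Fm.isSentence_iff {A : Fm} : A.IsSentence ↔ ∀ v, v ∉ A.fv :=
  Finset.eq_empty_iff_forall_notMem

theorem isConstant_abs {n : ℕ} {A : Fm} (h : ∀ v ∈ A.fv, v = n) : (Tm.abs n A).IsConstant := by
  rw [Tm.isConstant_iff]
  intro v
  simp only [Tm.fv, Finset.mem_erase, not_and]
  exact fun hv h' => hv (h v h')

section
variable {v : ℕ} {a b c : Tm} {A : Fm}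

theorem mem_fv_eqn : v ∈ (eqn a b).fv ↔ v ≠ 100 ∧ (v ∈ a.fv ∨ v ∈ b.fv) := by
  simp [eqn]
theorem mem_fv_upair : v ∈ (upair a b).fv ↔ v ≠ 100 ∧ v ≠ 101 ∧ (v ∈ a.fv ∨ v ∈ b.fv) := by
  simp [upair, mem_fv_eqn]; tauto
theorem mem_fv_pair : v ∈ (pair a b).fv ↔ v ≠ 100 ∧ v ≠ 101 ∧ (v ∈ a.fv ∨ v ∈ b.fv) := by
  simp [pair, mem_fv_upair]; tauto
theorem mem_fv_pairAbs {i j : ℕ} :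
    v ∈ (pairAbs i j A).fv ↔ v ≠ 109 ∧ v ≠ i ∧ v ≠ j ∧ v ∈ A.fv := by
  simp [pairAbs, mem_fv_eqn, mem_fv_pair]; tauto
theorem mem_fv_succ : v ∈ (succ a).fv ↔ v ≠ 102 ∧ v ∈ a.fv := by
  simp [succ, mem_fv_eqn]; tauto
theorem mem_fv_diff : v ∈ (diff a b).fv ↔ v ≠ 108 ∧ (v ∈ a.fv ∨ v ∈ b.fv) := by
  simp [diff]
theorem mem_fv_valueIs : v ∈ (valueIs a b c).fv ↔
    v ∈ a.fv ∨ v ≠ 100 ∧ v ≠ 101 ∧ (v ∈ b.fv ∨ v ∈ c.fv) := by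
  simp [valueIs, mem_fv_eqn, mem_fv_pair]; tauto
theorem mem_fv_memValue : v ∈ (memValue a b c).fv ↔
    v ≠ 116 ∧ (v ∈ a.fv ∨ v ∈ b.fv ∨ v ≠ 100 ∧ v ≠ 101 ∧ v ∈ c.fv) := by
  simp [memValue, mem_fv_valueIs]; tauto
theorem mem_fv_firstOf : v ∈ (firstOf a).fv ↔ v ≠ 117 ∧ v ∈ a.fv := by
  simp [firstOf]; tauto

theorem isConstant_upair (ha : a.IsConstant) (hb : b.IsConstant) : (upair a b).IsConstant := by
  rw [Tm.isConstant_iff] at *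
  simp [mem_fv_upair, ha, hb]

theorem isConstant_pair (ha : a.IsConstant) (hb : b.IsConstant) : (pair a b).IsConstant :=
  isConstant_upair (isConstant_upair ha ha) (isConstant_upair ha hb)

theorem isConstant_empty : empty.IsConstant := by
  rw [Tm.isConstant_iff]
  simp +contextual [empty, mem_fv_eqn]

theorem isConstant_univSet : univSet.IsConstant := by
  rw [Tm.isConstant_iff]
  simp +contextual [univSet, mem_fv_eqn]

theorem isConstant_succ (ha : a.IsConstant) : (succ a).IsConstant := by
  rw [Tm.isConstant_iff] at *
  simp [mem_fv_succ, ha]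

theorem isConstant_firstOf (ha : a.IsConstant) : (firstOf a).IsConstant := by
  rw [Tm.isConstant_iff] at *
  simp [mem_fv_firstOf, ha]

theorem isConstant_omega : omega.IsConstant := by
  rw [Tm.isConstant_iff]
  simp [omega, mem_fv_succ, Tm.isConstant_iff.1 isConstant_empty]
  tauto

theorem isConstant_choice : choice.IsConstant := by
  rw [Tm.isConstant_iff]
  simp [choice, mem_fv_pairAbs, mem_fv_eqn, mem_fv_firstOf]
  tauto

theorem isConstant_iteratedChoice : (iteratedChoice univSet).IsConstant := by
  rw [Tm.isConstant_iff]
  simp [iteratedChoice, manifestation, mem_fv_pairAbs, mem_fv_eqn, mem_fv_pair, mem_fv_valueIs,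
    mem_fv_diff, mem_fv_memValue, mem_fv_succ, Tm.isConstant_iff.1 isConstant_univSet,
    Tm.isConstant_iff.1 isConstant_choice, Tm.isConstant_iff.1 isConstant_omega,
    Tm.isConstant_iff.1 isConstant_empty]
  tauto

theorem isConstant_enumerator : enumerator.IsConstant := by
  rw [Tm.isConstant_iff]
  simp [enumerator, mem_fv_pairAbs, mem_fv_memValue, Tm.isConstant_iff.1 isConstant_iteratedChoice,
    Tm.isConstant_iff.1 isConstant_omega]
  tauto

theorem mem_fv_bijection : v ∈ (bijection a b c).fv → v ∈ a.fv ∨ v ∈ b.fv ∨ v ∈ c.fv := by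
  simp only [bijection, fv_conj, fv_imp, fv_ex, fv_isIn, Fm.fv, Finset.mem_union,
    Finset.mem_erase, mem_fv_eqn, mem_fv_pair, Tm.fv, Finset.mem_singleton]
  tauto

theorem isSentence_bijection (ha : a.IsConstant) (hb : b.IsConstant) (hc : c.IsConstant) :
    (bijection a b c).IsSentence := by
  rw [Tm.isConstant_iff] at *
  exact Fm.isSentence_iff.2 fun v hv => (mem_fv_bijection hv).elim (ha v) (Or.rec (hb v) (hc v))

theorem isSentence_ex_bijection {i : ℕ} (hb : b.IsConstant) (hc : c.IsConstant) :
    (ex i (bijection (.var i) b c)).IsSentence := by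
  rw [Tm.isConstant_iff] at *
  rw [Fm.isSentence_iff]
  intro v hv
  rw [fv_ex, Finset.mem_erase] at hv
  rcases mem_fv_bijection hv.2 with h | h | h
  · exact hv.1 (by simpa using h)
  · exact hb v h
  · exact hc v h

end

end FreeVariables

/-! ### Satisfaction at a stage -/

section Stages
variable {𝔅 : Barber} {n : ℕ} {α β : Ordinal.{0}} {A B : Fm} {a b t : Tm} {v : ℕ}

namespace Barber

@[simp] theorem sat_nor : 𝔅.Sat n α (.nor A B) ↔ ¬ 𝔅.Sat n α A ∧ ¬ 𝔅.Sat n α B := by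
  simp [Sat, Holds]
@[simp] theorem sat_neg : 𝔅.Sat n α (neg A) ↔ ¬ 𝔅.Sat n α A := by simp [neg]
@[simp] theorem sat_conj : 𝔅.Sat n α (conj A B) ↔ 𝔅.Sat n α A ∧ 𝔅.Sat n α B := by simp [conj]
@[simp] theorem sat_disj : 𝔅.Sat n α (disj A B) ↔ 𝔅.Sat n α A ∨ 𝔅.Sat n α B := by
  simp [disj]; tauto
@[simp] theorem sat_imp : 𝔅.Sat n α (imp A B) ↔ (𝔅.Sat n α A → 𝔅.Sat n α B) := by
  simp [imp]; tauto
theorem sat_all : 𝔅.Sat n α (.all v A) ↔ ∀ t : Tm, t.IsConstant → 𝔅.Sat n α (A.subst v t) := by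
  simp [Sat, Holds]
theorem sat_ex : 𝔅.Sat n α (ex v A) ↔ ∃ t : Tm, t.IsConstant ∧ 𝔅.Sat n α (A.subst v t) := by
  simp [ex, sat_all]

theorem sat_abs (h : α ≠ 0) : 𝔅.Sat n α (isIn t (.abs v A)) ↔
    ∃ γ < α, ∀ δ, γ ≤ δ → δ < α → 𝔅.Sat n δ (A.subst v t) := by
  unfold Sat isIn
  rw [Holds, Barber.mem]
  simp [h]

theorem sat_tr (h : α ≠ 0) : 𝔅.Sat n α (tr A) ↔
    ∃ γ < α, ∀ δ, γ ≤ δ → δ < α → 𝔅.Sat n δ A := by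
  unfold Sat tr
  rw [Holds, Barber.mem]
  simp [h]

theorem sat_abs_add_one : 𝔅.Sat n (α + 1) (isIn t (.abs v A)) ↔
    𝔅.Sat n α (A.subst v t) := by
  rw [sat_abs (by simp)]
  constructor
  · rintro ⟨γ, h, h'⟩
    exact h' α (Order.lt_add_one_iff.1 h) (lt_add_one α)
  · intro h
    refine ⟨α, lt_add_one α, fun δ h1 h2 => ?_⟩
    rwa [le_antisymm (Order.lt_add_one_iff.1 h2) h1]

theorem sat_tr_add_one : 𝔅.Sat n (α + 1) (tr A) ↔ 𝔅.Sat n α A := by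
  rw [sat_tr (by simp)]
  constructor
  · rintro ⟨γ, h, h'⟩
    exact h' α (Order.lt_add_one_iff.1 h) (lt_add_one α)
  · intro h
    refine ⟨α, lt_add_one α, fun δ h1 h2 => ?_⟩
    rwa [le_antisymm (Order.lt_add_one_iff.1 h2) h1]

theorem sat_eqn (ha : a.IsConstant) (hb : b.IsConstant) : 𝔅.Sat n α (eqn a b) ↔
    ∀ u : Tm, u.IsConstant → 𝔅.Sat n α (isIn a u) → 𝔅.Sat n α (isIn b u) := by
  simp [eqn, sat_all, ha.subst, hb.subst]

theorem sat_eqn_iff_coessential (ha : a.IsConstant) (hb : b.IsConstant) :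
    𝔅.Sat n α (eqn a b) ↔ Coessential (𝔅.mem n α) a b := by
  rw [sat_eqn ha hb]
  simp [Coessential, Sat, isIn, Holds]

theorem sat_eqn_self (ha : a.IsConstant) : 𝔅.Sat n α (eqn a a) :=
  (sat_eqn ha ha).2 fun _ _ h => h

end Barber

end Stages

namespace Barber

/-! ### Identity -/

section Identity
variable {𝔅 : Barber} {n : ℕ} {α β : Ordinal.{0}} {A B : Fm} {a b c d t : Tm} {v : ℕ}

/-- The constants `a` and `b` are identical at all stages. -/
def Eqv (𝔅 : Barber) (n : ℕ) (a b : Tm) : Prop := ∀ α, 𝔅.Sat n α (eqn a b)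

/-- An identity that fails once fails ever after: `{x | a = x}` has `a` as a member at each later
stage, but not `b`. -/
theorem not_sat_eqn_of_lt (ha : a.IsConstant) (hb : b.IsConstant) (hα : ¬ 𝔅.Sat n α (eqn a b))
    (h : α < β) : ¬ 𝔅.Sat n β (eqn a b) := by
  induction β using WellFoundedLT.induction with
  | ind β ih =>
    have hβ : β ≠ 0 := (zero_le.trans_lt h).ne'
    have hu : (Tm.abs 0 (eqn a (.var 0))).IsConstant := by
      rw [Tm.isConstant_iff] at *
      simp [mem_fv_eqn, ha]
      tauto
    have key : ∀ x : Tm, (eqn a (.var 0)).subst 0 x = eqn a x := fun x => by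
      simp [subst_eqn, ha.subst]
    intro hs
    have h1 := (sat_eqn ha hb).1 hs _ hu
      ((sat_abs hβ).2 ⟨0, pos_iff_ne_zero.2 hβ, fun δ _ _ => by rw [key]; exact sat_eqn_self ha⟩)
    obtain ⟨γ, hγ, h2⟩ := (sat_abs hβ).1 h1
    have h3 := h2 (max γ α) (le_max_left _ _) (max_lt hγ h)
    rw [key] at h3
    rcases (le_max_right γ α).eq_or_lt with e | e
    · exact hα (e ▸ h3)
    · exact ih _ (max_lt hγ h) e h3

theorem Eqv.refl (ha : a.IsConstant) : 𝔅.Eqv n a a := fun _ => sat_eqn_self ha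

theorem Eqv.trans (ha : a.IsConstant) (hb : b.IsConstant) (hc : c.IsConstant)
    (h : 𝔅.Eqv n a b) (h' : 𝔅.Eqv n b c) : 𝔅.Eqv n a c := fun α =>
  (sat_eqn ha hc).2 fun u hu h1 => (sat_eqn hb hc).1 (h' α) u hu ((sat_eqn ha hb).1 (h α) u hu h1)

theorem Eqv.sat_imp (ha : a.IsConstant) (hb : b.IsConstant) (h : 𝔅.Eqv n a b)
    (hA : ∀ w ∈ A.fv, w = v) (hs : 𝔅.Sat n α (A.subst v a)) : 𝔅.Sat n α (A.subst v b) :=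
  sat_abs_add_one.1 ((sat_eqn ha hb).1 (h (α + 1)) _ (isConstant_abs hA) (sat_abs_add_one.2 hs))

theorem Eqv.symm (ha : a.IsConstant) (hb : b.IsConstant) (h : 𝔅.Eqv n a b) : 𝔅.Eqv n b a := by
  intro α
  have key : ∀ x : Tm, (eqn (.var 0) a).subst 0 x = eqn x a := fun x => by
    simp [subst_eqn, ha.subst]
  have := h.sat_imp (v := 0) (A := eqn (.var 0) a) (α := α) ha hb (by
    rw [Tm.isConstant_iff] at ha
    simp [mem_fv_eqn, ha]) (by rw [key]; exact sat_eqn_self ha)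
  rwa [key] at this

theorem Eqv.sat_iff (ha : a.IsConstant) (hb : b.IsConstant) (h : 𝔅.Eqv n a b)
    (hA : ∀ w ∈ A.fv, w = v) : 𝔅.Sat n α (A.subst v a) ↔ 𝔅.Sat n α (A.subst v b) :=
  ⟨h.sat_imp ha hb hA, (h.symm ha hb).sat_imp hb ha hA⟩

/-- Since names are transparent, identicals are interchangeable within terms. -/
theorem Eqv.congr_subst (ha : a.IsConstant) (hb : b.IsConstant) (h : 𝔅.Eqv n a b) (hv : 100 ≠ v)
    (ht : ∀ w ∈ t.fv, w = v) : 𝔅.Eqv n (t.subst v a) (t.subst v b) := by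
  have hc : (t.subst v a).IsConstant := by
    rw [Tm.isConstant_iff, Tm.fv_subst ha]
    intro w hw
    exact (Finset.mem_erase.1 hw).1 (ht w (Finset.mem_erase.1 hw).2)
  intro α
  have := h.sat_imp (v := v) (A := eqn (t.subst v a) t) (α := α) ha hb (by
    intro w hw
    rw [mem_fv_eqn] at hw
    exact ht w (hw.2.resolve_left (Tm.isConstant_iff.1 hc w))) (by
      rw [subst_eqn _ _ _ hv, hc.subst]; exact sat_eqn_self hc)
  rwa [subst_eqn _ _ _ hv, hc.subst] at this

theorem Eqv.upair (ha : a.IsConstant) (hb : b.IsConstant) (hc : c.IsConstant) (hd : d.IsConstant)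
    (h : 𝔅.Eqv n a c) (h' : 𝔅.Eqv n b d) : 𝔅.Eqv n (upair a b) (upair c d) := by
  have h1 := h.congr_subst (t := Librationism.upair (.var 0) b) (v := 0) ha hc (by simp) (by
    simp [mem_fv_upair, Tm.isConstant_iff.1 hb])
  have h2 := h'.congr_subst (t := Librationism.upair c (.var 0)) (v := 0) hb hd (by simp) (by
    simp [mem_fv_upair, Tm.isConstant_iff.1 hc])
  simp only [subst_upair, hb.subst, hc.subst, subst_var_self, ne_eq,
    OfNat.ofNat_ne_zero, not_false_eq_true] at h1 h2
  exact h1.trans (isConstant_upair ha hb) (isConstant_upair hc hb) (isConstant_upair hc hd) h2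

theorem Eqv.pair (ha : a.IsConstant) (hb : b.IsConstant) (hc : c.IsConstant) (hd : d.IsConstant)
    (h : 𝔅.Eqv n a c) (h' : 𝔅.Eqv n b d) : 𝔅.Eqv n (pair a b) (pair c d) :=
  Eqv.upair (isConstant_upair ha ha) (isConstant_upair ha hb) (isConstant_upair hc hc)
    (isConstant_upair hc hd) (Eqv.upair ha ha hc hc h h) (Eqv.upair ha hb hc hd h h')

theorem Eqv.succ (ha : a.IsConstant) (hb : b.IsConstant) (h : 𝔅.Eqv n a b) :
    𝔅.Eqv n (succ a) (succ b) := by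
  have h1 := h.congr_subst (t := Librationism.succ (.var 0)) (v := 0) ha hb (by simp) (by
    simp [mem_fv_succ])
  simpa [subst_succ] using h1

theorem Eqv.sat_isIn_left (ha : a.IsConstant) (hb : b.IsConstant) (ht : t.IsConstant)
    (h : 𝔅.Eqv n a b) : 𝔅.Sat n α (isIn a t) ↔ 𝔅.Sat n α (isIn b t) :=
  ⟨(sat_eqn ha hb).1 (h α) t ht, (sat_eqn hb ha).1 (h.symm ha hb α) t ht⟩

theorem Eqv.sat_isIn_right (ha : a.IsConstant) (hb : b.IsConstant) (ht : t.IsConstant)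
    (h : 𝔅.Eqv n a b) : 𝔅.Sat n α (isIn t a) ↔ 𝔅.Sat n α (isIn t b) := by
  have := h.sat_iff (A := isIn t (.var 0)) (v := 0) (α := α) ha hb (by
    simp [Tm.isConstant_iff.1 ht])
  simpa [ht.subst] using this

end Identity

/-! ### Eventual truth values -/

section Decides
variable {𝔅 : Barber} {n : ℕ} {α β : Ordinal.{0}} {A B : Fm} {a b c d t : Tm} {v : ℕ} {P Q : Prop}

/-- From some stage on, the sentence `A` holds just if `P` does. -/
def Decides (𝔅 : Barber) (n : ℕ) (A : Fm) (P : Prop) : Prop :=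
  ∃ α, ∀ β, α ≤ β → (𝔅.Sat n β A ↔ P)

/-- A family of ordinals that is indexed by a type in the lowest universe is bounded, so that all
expressions settle from a common stage on if each does. -/
theorem exists_forall_ge {ι : Type} {p : Ordinal.{0} → ι → Prop}
    (h : ∀ i, ∃ α, ∀ β, α ≤ β → p β i) : ∃ α, ∀ β, α ≤ β → ∀ i, p β i := by
  choose f hf using h
  exact ⟨⨆ i, f i, fun β hβ i => hf i β ((Ordinal.le_iSup f i).trans hβ)⟩

theorem Decides.congr (h : 𝔅.Decides n A P) (e : P ↔ Q) : 𝔅.Decides n A Q := by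
  rwa [propext e] at h

theorem Decides.unique (h : 𝔅.Decides n A P) (h' : 𝔅.Decides n A Q) : P ↔ Q := by
  obtain ⟨α, h⟩ := h
  obtain ⟨β, h'⟩ := h'
  rw [← h (max α β) (le_max_left _ _), h' (max α β) (le_max_right _ _)]

theorem Decides.of_sat_iff (e : ∀ α, 𝔅.Sat n α A ↔ 𝔅.Sat n α B) (h : 𝔅.Decides n A P) :
    𝔅.Decides n B P :=
  h.imp fun _ h β hβ => (e β).symm.trans (h β hβ)

theorem Decides.neg (h : 𝔅.Decides n A P) : 𝔅.Decides n (neg A) (¬ P) :=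
  h.imp fun _ h β hβ => by rw [sat_neg, h β hβ]

/-- The second conjunct need be decided only when the first one holds. -/
theorem Decides.conj (h : 𝔅.Decides n A P) (h' : P → 𝔅.Decides n B Q) :
    𝔅.Decides n (conj A B) (P ∧ Q) := by
  obtain ⟨α, h⟩ := h
  by_cases hP : P
  · obtain ⟨α', h'⟩ := h' hP
    refine ⟨max α α', fun β hβ => ?_⟩
    rw [sat_conj, h β ((le_max_left _ _).trans hβ), h' β ((le_max_right _ _).trans hβ)]
  · exact ⟨α, fun β hβ => by rw [sat_conj, h β hβ]; simp [hP]⟩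

theorem Decides.disj (h : 𝔅.Decides n A P) (h' : 𝔅.Decides n B Q) :
    𝔅.Decides n (disj A B) (P ∨ Q) := by
  obtain ⟨α, h⟩ := h
  obtain ⟨α', h'⟩ := h'
  refine ⟨max α α', fun β hβ => ?_⟩
  rw [sat_disj, h β ((le_max_left _ _).trans hβ), h' β ((le_max_right _ _).trans hβ)]

theorem Decides.imp (h : 𝔅.Decides n A P) (h' : P → 𝔅.Decides n B Q) :
    𝔅.Decides n (imp A B) (P → Q) := by
  obtain ⟨α, h⟩ := h
  by_cases hP : P
  · obtain ⟨α', h'⟩ := h' hP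
    refine ⟨max α α', fun β hβ => ?_⟩
    rw [Barber.sat_imp, h β ((le_max_left _ _).trans hβ), h' β ((le_max_right _ _).trans hβ)]
  · exact ⟨α, fun β hβ => by rw [Barber.sat_imp, h β hβ]; simp [hP]⟩

theorem Decides.all {P : Tm → Prop} (h : ∀ t, t.IsConstant → 𝔅.Decides n (A.subst v t) (P t)) :
    𝔅.Decides n (.all v A) (∀ t, t.IsConstant → P t) := by
  obtain ⟨α, h⟩ := exists_forall_ge (fun i : {t : Tm // t.IsConstant} => h i.1 i.2)
  refine ⟨α, fun β hβ => ?_⟩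
  rw [sat_all]
  exact forall₂_congr fun t ht => h β hβ ⟨t, ht⟩

theorem Decides.ex {P : Tm → Prop} (h : ∀ t, t.IsConstant → 𝔅.Decides n (A.subst v t) (P t)) :
    𝔅.Decides n (ex v A) (∃ t, t.IsConstant ∧ P t) :=
  (Decides.all (A := Librationism.neg A) (P := fun t => ¬ P t) fun t ht => by
    simpa using (h t ht).neg).neg.congr (by simp)

theorem Decides.abs (h : 𝔅.Decides n (A.subst v t) P) : 𝔅.Decides n (isIn t (.abs v A)) P := by
  obtain ⟨α, h⟩ := h
  refine ⟨α + 1, fun β hβ => ?_⟩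
  have hαβ := Order.add_one_le_iff.1 hβ
  rw [sat_abs (zero_le.trans_lt hαβ).ne']
  constructor
  · rintro ⟨γ, hγ, h1⟩
    exact (h _ (le_max_right γ α)).1 (h1 _ (le_max_left γ α) (max_lt hγ hαβ))
  · exact fun hP => ⟨α, hαβ, fun δ hδ _ => (h δ hδ).2 hP⟩

theorem Decides.tr (h : 𝔅.Decides n A P) : 𝔅.Decides n (tr A) P := by
  obtain ⟨α, h⟩ := h
  refine ⟨α + 1, fun β hβ => ?_⟩
  have hαβ := Order.add_one_le_iff.1 hβ
  rw [sat_tr (zero_le.trans_lt hαβ).ne']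
  constructor
  · rintro ⟨γ, hγ, h1⟩
    exact (h _ (le_max_right γ α)).1 (h1 _ (le_max_left γ α) (max_lt hγ hαβ))
  · exact fun hP => ⟨α, hαβ, fun δ hδ _ => (h δ hδ).2 hP⟩

theorem decides_eqn (ha : a.IsConstant) (hb : b.IsConstant) :
    𝔅.Decides n (eqn a b) (𝔅.Eqv n a b) := by
  by_cases h : 𝔅.Eqv n a b
  · exact ⟨0, fun β _ => by simp [h, h β]⟩
  · obtain ⟨α, hα⟩ := not_forall.1 h
    refine ⟨α + 1, fun β hβ => ?_⟩
    simp [h, not_sat_eqn_of_lt ha hb hα (Order.add_one_le_iff.1 hβ)]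

theorem exists_forall_sat_eqn_iff (𝔅 : Barber) (n : ℕ) : ∃ α, ∀ β, α ≤ β → ∀ a b : Tm,
    a.IsConstant → b.IsConstant → (𝔅.Sat n β (eqn a b) ↔ 𝔅.Eqv n a b) := by
  obtain ⟨α, h⟩ := exists_forall_ge
    (fun i : {t : Tm // t.IsConstant} × {t : Tm // t.IsConstant} =>
      decides_eqn (𝔅 := 𝔅) (n := n) i.1.2 i.2.2)
  exact ⟨α, fun β hβ a b ha hb => h β hβ (⟨a, ha⟩, ⟨b, hb⟩)⟩

/-! ### Pairs -/

theorem decides_mem_upair (ha : a.IsConstant) (hb : b.IsConstant) (ht : t.IsConstant) :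
    𝔅.Decides n (isIn t (Librationism.upair a b)) (𝔅.Eqv n t a ∨ 𝔅.Eqv n t b) := by
  refine Decides.abs ?_
  simpa [subst_eqn, ha.subst, hb.subst] using (decides_eqn ht ha).disj (decides_eqn ht hb)

theorem Eqv.upair_mem_iff (ha : a.IsConstant) (hb : b.IsConstant) (hc : c.IsConstant)
    (hd : d.IsConstant) (h : 𝔅.Eqv n (Librationism.upair a b) (Librationism.upair c d))
    (ht : t.IsConstant) : (𝔅.Eqv n t a ∨ 𝔅.Eqv n t b) ↔ (𝔅.Eqv n t c ∨ 𝔅.Eqv n t d) :=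
  (decides_mem_upair ha hb ht).unique ((decides_mem_upair hc hd ht).of_sat_iff fun _ =>
    (h.sat_isIn_right (isConstant_upair ha hb) (isConstant_upair hc hd) ht).symm)

theorem eqv_pair_iff (ha : a.IsConstant) (hb : b.IsConstant) (hc : c.IsConstant)
    (hd : d.IsConstant) : 𝔅.Eqv n (Librationism.pair a b) (Librationism.pair c d) ↔
      𝔅.Eqv n a c ∧ 𝔅.Eqv n b d := by
  refine ⟨fun h => ?_, fun h => Eqv.pair ha hb hc hd h.1 h.2⟩
  have haa := isConstant_upair ha ha
  have hab := isConstant_upair ha hb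
  have hcc := isConstant_upair hc hc
  have hcd := isConstant_upair hc hd
  have hm := fun t ht => Eqv.upair_mem_iff haa hab hcc hcd h (t := t) ht
  have tr := fun x y z hx hy hz => Eqv.trans (𝔅 := 𝔅) (n := n) (a := x) (b := y) (c := z) hx hy hz
  have sy := fun x y hx hy => Eqv.symm (𝔅 := 𝔅) (n := n) (a := x) (b := y) hx hy
  have key := fun x y z w hx hy hz hw e t ht =>
    Eqv.upair_mem_iff (𝔅 := 𝔅) (n := n) (a := x) (b := y) (c := z) (d := w) (t := t)
      hx hy hz hw e ht
  have r := fun x hx => Eqv.refl (𝔅 := 𝔅) (n := n) (a := x) hx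
  have hac : 𝔅.Eqv n a c := by
    rcases (hm _ haa).1 (.inl (r _ haa)) with e | e
    · simpa using (key _ _ _ _ ha ha hc hc e _ ha).1 (.inl (r _ ha))
    · exact sy _ _ hc ha (by simpa using (key _ _ _ _ ha ha hc hd e _ hc).2 (.inl (r _ hc)))
  refine ⟨hac, ?_⟩
  -- `{a, b}` is `{c}` or `{c, d}`, and `{c, d}` is `{a}` or `{a, b}`
  have h1 : 𝔅.Eqv n b c ∨ 𝔅.Eqv n b d := by
    rcases (hm _ hab).1 (.inr (r _ hab)) with e | e
    · exact .inl (by simpa using (key _ _ _ _ ha hb hc hc e _ hb).1 (.inr (r _ hb)))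
    · exact (key _ _ _ _ ha hb hc hd e _ hb).1 (.inr (r _ hb))
  have h2 : 𝔅.Eqv n d a ∨ 𝔅.Eqv n d b := by
    rcases (hm _ hcd).2 (.inr (r _ hcd)) with e | e
    · exact .inl (by simpa using (key _ _ _ _ hc hd ha ha e _ hd).1 (.inr (r _ hd)))
    · exact (key _ _ _ _ hc hd ha hb e _ hd).1 (.inr (r _ hd))
  rcases h1 with h1 | h1
  · rcases h2 with h2 | h2
    · exact tr _ _ _ hb hc hd h1 (tr _ _ _ hc ha hd (sy _ _ ha hc hac) (sy _ _ hd ha h2))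
    · exact sy _ _ hd hb h2
  · exact h1

end Decides

section Relations
variable {𝔅 : Barber} {n : ℕ} {α β : Ordinal.{0}} {A B : Fm} {a b c d p t w : Tm} {v i j : ℕ}
  {P Q : Prop}

/-- The identities that hold at `β` are those that hold at all stages. -/
def IdStable (𝔅 : Barber) (n : ℕ) (β : Ordinal.{0}) : Prop :=
  ∀ a b : Tm, a.IsConstant → b.IsConstant → (𝔅.Sat n β (eqn a b) ↔ 𝔅.Eqv n a b)

/-- The matrix of `pairAbs`, with constants put for its variables. -/
theorem subst_subst_pair_conj (hij : i ≠ j) (hi : i ∉ ({100, 101, 109} : Finset ℕ))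
    (hj : j ∉ ({100, 101, 109} : Finset ℕ)) (hp : p.IsConstant) (ha : a.IsConstant) :
    ((conj (eqn p (pair (.var i) (.var j))) A).subst i a).subst j b =
      conj (eqn p (pair a b)) ((A.subst i a).subst j b) := by
  simp only [Finset.mem_insert, Finset.mem_singleton, not_or, ne_comm (a := i),
    ne_comm (a := j)] at hi hj
  simp [subst_eqn, subst_pair, subst_var_ne, hij.symm, hi, hj, hp.subst, ha.subst]

theorem subst_pairAbs_body (hi : i ∉ ({100, 101, 109} : Finset ℕ))
    (hj : j ∉ ({100, 101, 109} : Finset ℕ)) (hA : ∀ v ∈ A.fv, v = i ∨ v = j) :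
    (ex i (ex j (conj (eqn (.var 109) (pair (.var i) (.var j))) A))).subst 109 p =
      ex i (ex j (conj (eqn p (pair (.var i) (.var j))) A)) := by
  simp only [Finset.mem_insert, Finset.mem_singleton, not_or] at hi hj
  have h109 : 109 ∉ A.fv := fun h => by rcases hA _ h with h | h <;> simp_all
  simp [subst_ex, subst_eqn, subst_pair, subst_var_ne, hi, hj, A.subst_of_notMem h109]

/-- Membership of a pair in a set of pairs, without the delay by one stage. -/
theorem sat_subst_pairAbs (hβ : 𝔅.IdStable n β) (hij : i ≠ j)
    (hi : i ∉ ({100, 101, 109} : Finset ℕ)) (hj : j ∉ ({100, 101, 109} : Finset ℕ))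
    (hA : ∀ v ∈ A.fv, v = i ∨ v = j) (ha : a.IsConstant) (hb : b.IsConstant) :
    𝔅.Sat n β ((ex i (ex j (conj (eqn (.var 109) (pair (.var i) (.var j))) A))).subst 109
      (pair a b)) ↔ 𝔅.Sat n β ((A.subst i a).subst j b) := by
  have hab := isConstant_pair ha hb
  have hf : ∀ s, s.IsConstant → ∀ v ∈ (A.subst i s).fv, v = j := fun s hs v hv => by
    rw [Fm.fv_subst hs, Finset.mem_erase] at hv
    exact (hA v hv.2).resolve_left hv.1
  have hf' : ∀ s, s.IsConstant → ∀ v ∈ (A.subst j s).fv, v = i := fun s hs v hv => by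
    rw [Fm.fv_subst hs, Finset.mem_erase] at hv
    exact (hA v hv.2).resolve_right hv.1
  rw [subst_pairAbs_body hi hj hA, sat_ex]
  constructor
  · rintro ⟨s, hs, h⟩
    rw [subst_ex _ _ hij.symm, sat_ex] at h
    obtain ⟨t, ht, h⟩ := h
    rw [subst_subst_pair_conj hij hi hj hab hs, sat_conj, hβ _ _ hab (isConstant_pair hs ht),
      eqv_pair_iff ha hb hs ht] at h
    obtain ⟨⟨h1, h2⟩, h⟩ := h
    rw [← h2.sat_iff hb ht (hf s hs), Fm.subst_comm hs hb hij,
      ← h1.sat_iff ha hs (hf' b hb)] at h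
    rwa [Fm.subst_comm ha hb hij]
  · intro h
    refine ⟨a, ha, ?_⟩
    rw [subst_ex _ _ hij.symm, sat_ex]
    refine ⟨b, hb, ?_⟩
    rw [subst_subst_pair_conj hij hi hj hab ha, sat_conj]
    exact ⟨sat_eqn_self hab, h⟩

theorem decides_pair_mem_pairAbs (hij : i ≠ j)
    (hi : i ∉ ({100, 101, 109} : Finset ℕ)) (hj : j ∉ ({100, 101, 109} : Finset ℕ))
    (hA : ∀ v ∈ A.fv, v = i ∨ v = j) (ha : a.IsConstant) (hb : b.IsConstant)
    (h : 𝔅.Decides n ((A.subst i a).subst j b) P) :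
    𝔅.Decides n (isIn (pair a b) (pairAbs i j A)) P := by
  obtain ⟨α, h⟩ := h
  obtain ⟨α', h'⟩ := exists_forall_sat_eqn_iff 𝔅 n
  refine Decides.abs ⟨max α α', fun β hβ => ?_⟩
  rw [sat_subst_pairAbs (h' β ((le_max_right _ _).trans hβ)) hij hi hj hA ha hb]
  exact h β ((le_max_left _ _).trans hβ)

theorem decides_mem_pairAbs {P : Tm → Tm → Prop} (hij : i ≠ j)
    (hi : i ∉ ({100, 101, 109} : Finset ℕ)) (hj : j ∉ ({100, 101, 109} : Finset ℕ))
    (hA : ∀ v ∈ A.fv, v = i ∨ v = j) (hp : p.IsConstant)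
    (h : ∀ s t, s.IsConstant → t.IsConstant → 𝔅.Decides n ((A.subst i s).subst j t) (P s t)) :
    𝔅.Decides n (isIn p (pairAbs i j A))
      (∃ s, s.IsConstant ∧ ∃ t, t.IsConstant ∧ 𝔅.Eqv n p (pair s t) ∧ P s t) := by
  refine Decides.abs ?_
  rw [subst_pairAbs_body hi hj hA]
  refine Decides.ex fun s hs => ?_
  rw [subst_ex _ _ hij.symm]
  refine Decides.ex fun t ht => ?_
  rw [subst_subst_pair_conj hij hi hj hp hs]
  exact (decides_eqn hp (isConstant_pair hs ht)).conj fun _ => h s t hs ht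

end Relations

/-! ### Manifestation sets -/

/-- `{w | ⟨w, z⟩ ∈ z}` -/
def diagonal (z : Tm) : Tm := .abs 112 (isIn (pair (.var 112) z) z)

/-- The set of pairs whose diagonal is the manifestation set of `A`. -/
def manifestationBase (A : Tm → Tm → Fm) : Tm :=
  pairAbs 110 111 (A (.var 110) (diagonal (.var 111)))

theorem manifestation_eq (A : Tm → Tm → Fm) :
    manifestation A = diagonal (manifestationBase A) := rfl

/-- The operator `A` on terms is given by a formula in the two variables that `manifestation` uses:
putting constants for them commutes with `A`, without capture. -/
structure Uniform (A : Tm → Tm → Fm) : Prop where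
  fv : ∀ v ∈ (A (.var 110) (diagonal (.var 111))).fv, v = 110 ∨ v = 111
  subst : ∀ w z, w.IsConstant → z.IsConstant →
    ((A (.var 110) (diagonal (.var 111))).subst 110 w).subst 111 z = A w (diagonal z)

section Manifestation
variable {𝔅 : Barber} {n : ℕ} {α β : Ordinal.{0}} {A : Tm → Tm → Fm} {w z : Tm} {P : Prop}

theorem subst_diagonal {v : ℕ} {t : Tm} (h100 : 100 ≠ v) (h101 : 101 ≠ v) (h112 : 112 ≠ v) :
    (diagonal z).subst v t = diagonal (z.subst v t) := by
  simp [diagonal, subst_abs, subst_pair, subst_var_ne, *]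

theorem mem_fv_diagonal {v : ℕ} : v ∈ (diagonal z).fv ↔ v ≠ 112 ∧ v ∈ z.fv := by
  simp [diagonal, mem_fv_pair]
  tauto

theorem isConstant_diagonal (hz : z.IsConstant) : (diagonal z).IsConstant := by
  rw [Tm.isConstant_iff] at *
  simp [mem_fv_diagonal, hz]

theorem Uniform.isConstant_base (hA : Uniform A) : (manifestationBase A).IsConstant := by
  rw [Tm.isConstant_iff]
  intro v hv
  rw [manifestationBase, mem_fv_pairAbs] at hv
  have := hA.fv v hv.2.2.2
  tauto

theorem Uniform.isConstant_manifestation (hA : Uniform A) : (manifestation A).IsConstant :=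
  isConstant_diagonal hA.isConstant_base

theorem sat_subst_diagonal (hz : z.IsConstant) :
    𝔅.Sat n β ((isIn (pair (.var 112) z) z).subst 112 w) ↔ 𝔅.Sat n β (isIn (pair w z) z) := by
  simp [subst_pair, hz.subst]

theorem sat_add_one_mem_manifestationBase (hA : Uniform A) (hβ : 𝔅.IdStable n β)
    (hw : w.IsConstant) :
    𝔅.Sat n (β + 1) (isIn (pair w (manifestationBase A)) (manifestationBase A)) ↔
      𝔅.Sat n β (A w (manifestation A)) := by
  have hb := hA.isConstant_base
  conv_lhs => rw [show isIn (pair w (manifestationBase A)) (manifestationBase A) =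
    isIn (pair w (manifestationBase A))
      (pairAbs 110 111 (A (.var 110) (diagonal (.var 111)))) from rfl]
  rw [pairAbs, sat_abs_add_one, sat_subst_pairAbs hβ (by simp) (by simp) (by simp) hA.fv hw hb,
    hA.subst _ _ hw hb, manifestation_eq]

theorem sat_add_one_mem_manifestation (hA : Uniform A) :
    𝔅.Sat n (β + 1) (isIn w (manifestation A)) ↔
      𝔅.Sat n β (isIn (pair w (manifestationBase A)) (manifestationBase A)) := by
  rw [manifestation_eq, diagonal, sat_abs_add_one, sat_subst_diagonal hA.isConstant_base]

/-- The fixed point property of a manifestation set, with a delay of two stages. -/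
theorem sat_add_two_mem_manifestation (hA : Uniform A) (hβ : 𝔅.IdStable n β)
    (hw : w.IsConstant) :
    𝔅.Sat n (β + 1 + 1) (isIn w (manifestation A)) ↔
      𝔅.Sat n β (A w (manifestation A)) := by
  rw [sat_add_one_mem_manifestation hA, sat_add_one_mem_manifestationBase hA hβ hw]

theorem decides_mem_manifestation (hA : Uniform A) (hw : w.IsConstant)
    (h : 𝔅.Decides n (A w (manifestation A)) P) :
    𝔅.Decides n (isIn w (manifestation A)) P := by
  have hb := hA.isConstant_base
  refine Decides.abs (Decides.of_sat_iff (fun _ => (sat_subst_diagonal hb).symm) ?_)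
  refine decides_pair_mem_pairAbs (by simp) (by simp) (by simp) hA.fv hw hb ?_
  rwa [hA.subst _ _ hw hb]

end Manifestation

/-! ### Numerals -/

/-- The numeral of `k`. -/
def num : ℕ → Tm
  | 0 => empty
  | k + 1 => succ (num k)

theorem isConstant_num : ∀ k, (num k).IsConstant
  | 0 => isConstant_empty
  | k + 1 => isConstant_succ (isConstant_num k)

section Numerals
variable {𝔅 : Barber} {n : ℕ} {α β : Ordinal.{0}} {A : Tm → Tm → Fm} {a t w x z : Tm} {P : Prop}

theorem decides_mem_succ (ha : a.IsConstant) (ht : t.IsConstant)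
    (h : 𝔅.Decides n (isIn t a) P) : 𝔅.Decides n (isIn t (succ a)) (𝔅.Eqv n t a ∨ P) := by
  refine Decides.abs ?_
  simpa [subst_eqn, ha.subst] using (decides_eqn ht ha).disj h

theorem decides_mem_num (ht : t.IsConstant) :
    ∀ k, 𝔅.Decides n (isIn t (num k)) (∃ i < k, 𝔅.Eqv n t (num i))
  | 0 => by
      refine Decides.abs ?_
      simpa [subst_eqn, Eqv.refl ht] using (decides_eqn (𝔅 := 𝔅) (n := n) ht ht).neg
  | k + 1 => by
      refine (decides_mem_succ (isConstant_num k) ht (decides_mem_num ht k)).congr ?_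
      constructor
      · rintro (h | ⟨i, hi, h⟩)
        · exact ⟨k, by simp, h⟩
        · exact ⟨i, by omega, h⟩
      · rintro ⟨i, hi, h⟩
        rcases Nat.lt_succ_iff_lt_or_eq.1 hi with hi | rfl
        · exact .inr ⟨i, hi, h⟩
        · exact .inl h

theorem not_eqv_num_of_lt : ∀ {i k : ℕ}, i < k → ¬ 𝔅.Eqv n (num i) (num k) := by
  intro i
  induction i using Nat.strong_induction_on with
  | _ i ih =>
    intro k hik h
    -- `i` is in `k`, hence in `i`
    have h1 := (decides_mem_num (𝔅 := 𝔅) (n := n) (isConstant_num i) k).of_sat_iff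
      (fun _ => (h.sat_isIn_right (isConstant_num i) (isConstant_num k) (isConstant_num i)).symm)
    obtain ⟨l, hl, h2⟩ := ((decides_mem_num (isConstant_num i) i).unique h1).2
      ⟨i, hik, Eqv.refl (isConstant_num i)⟩
    exact ih l hl hl (h2.symm (isConstant_num i) (isConstant_num l))

theorem eqv_num_iff {i k : ℕ} : 𝔅.Eqv n (num i) (num k) ↔ i = k := by
  constructor
  · intro h
    rcases lt_trichotomy i k with h' | h' | h'
    · exact absurd h (not_eqv_num_of_lt h')
    · exact h'
    · exact absurd (h.symm (isConstant_num i) (isConstant_num k)) (not_eqv_num_of_lt h')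
  · rintro rfl
    exact Eqv.refl (isConstant_num i)

theorem eqv_num_unique (ht : t.IsConstant) {i k : ℕ} (h : 𝔅.Eqv n t (num i))
    (h' : 𝔅.Eqv n t (num k)) : i = k :=
  eqv_num_iff.1 ((h.symm ht (isConstant_num i)).trans (isConstant_num i) ht (isConstant_num k) h')

/-! ### A set that consists of the numerals at some stage -/

/-- The set of the sets that are not members of themselves. -/
def russell : Tm := .abs 0 (neg (isIn (.var 0) (.var 0)))

theorem isConstant_russell : russell.IsConstant := by
  rw [Tm.isConstant_iff]
  simp [russell]

theorem sat_add_one_russell : 𝔅.Sat n (α + 1) (isIn russell russell) ↔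
    ¬ 𝔅.Sat n α (isIn russell russell) := by
  conv_lhs => rw [russell, sat_abs_add_one]
  simp [russell]

/-- A sentence that holds at the limit stages, but at no successor stage: the truth value of
`russell ∈ russell` changes at each successor stage, and so is unsettled at each limit stage. -/
def limitSentence : Fm := .nor (tr (isIn russell russell)) (tr (neg (isIn russell russell)))

theorem not_sat_add_one_limitSentence : ¬ 𝔅.Sat n (α + 1) limitSentence := by
  simp [limitSentence, sat_tr_add_one]

theorem sat_limitSentence (h : Order.IsSuccLimit α) : 𝔅.Sat n α limitSentence := by
  have h0 : α ≠ 0 := h.ne_bot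
  rw [limitSentence, sat_nor, sat_tr h0, sat_tr h0]
  constructor
  · rintro ⟨γ, hγ, h1⟩
    exact sat_add_one_russell.1 (h1 _ (Order.le_succ γ : γ ≤ γ + 1) (h.succ_lt hγ)) (h1 γ le_rfl hγ)
  · rintro ⟨γ, hγ, h1⟩
    have h2 := h1 _ (Order.le_succ γ : γ ≤ γ + 1) (h.succ_lt hγ)
    replace h2 := sat_add_one_russell.not.1 (sat_neg.1 h2)
    exact h2 (sat_neg.1 (h1 γ le_rfl hγ))

/-- A sentence that fails at a limit stage and at the stage after it, and holds at all later stages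
before the next limit. -/
def resetSentence : Fm := .nor limitSentence (tr limitSentence)

theorem not_sat_resetSentence (h : Order.IsSuccLimit α) : ¬ 𝔅.Sat n α resetSentence := by
  simp [resetSentence, sat_limitSentence h]

theorem not_sat_add_one_resetSentence (h : Order.IsSuccLimit α) :
    ¬ 𝔅.Sat n (α + 1) resetSentence := by
  simp [resetSentence, sat_tr_add_one, sat_limitSentence h]

theorem sat_add_two_resetSentence :
    𝔅.Sat n (α + 1 + 1) resetSentence := by
  simp [resetSentence, sat_tr_add_one, not_sat_add_one_limitSentence]

theorem isSentence_resetSentence : resetSentence.IsSentence := by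
  rw [Fm.isSentence_iff]
  simp [resetSentence, limitSentence, Tm.isConstant_iff.1 isConstant_russell]

/-- `w` is zero or a successor of a member of `h`, unless the count starts anew. -/
def countFm (w h : Tm) : Fm :=
  conj resetSentence (disj (eqn w empty)
    (ex 113 (conj (isIn (.var 113) h) (eqn w (succ (.var 113))))))

/-- The set that is emptied after each limit stage, and then takes up zero and the successors of
its members at every second stage. -/
def counter : Tm := manifestation countFm

theorem uniform_countFm : Uniform countFm where
  fv v := by
    simp [countFm, mem_fv_eqn, mem_fv_succ, mem_fv_diagonal,
      Fm.isSentence_iff.1 isSentence_resetSentence, Tm.isConstant_iff.1 isConstant_empty]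
    tauto
  subst w z hw hz := by
    simp [countFm, isSentence_resetSentence.subst 110, isSentence_resetSentence.subst 111,
      subst_eqn, subst_ex, subst_succ, subst_diagonal,
      subst_var_ne, isConstant_empty.subst, hw.subst]

theorem sat_add_two_mem_counter (hβ : 𝔅.IdStable n β) (hw : w.IsConstant) :
    𝔅.Sat n (β + 1 + 1) (isIn w counter) ↔ 𝔅.Sat n β resetSentence ∧
      (𝔅.Eqv n w empty ∨ ∃ z : Tm, z.IsConstant ∧ 𝔅.Sat n β (isIn z counter) ∧
        𝔅.Eqv n w (succ z)) := by
  have hc : counter.IsConstant := uniform_countFm.isConstant_manifestation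
  rw [counter, sat_add_two_mem_manifestation uniform_countFm hβ hw, ← counter, countFm, sat_conj,
    sat_disj, sat_ex, hβ _ _ hw isConstant_empty]
  refine and_congr_right fun _ => or_congr_right
    (exists_congr fun z => and_congr_right fun hz => ?_)
  rw [subst_conj, subst_isIn, sat_conj, subst_var_self, hc.subst, subst_eqn _ _ _ (by simp),
    hw.subst, subst_succ _ _ (by simp) (by simp), subst_var_self, hβ _ _ hw (isConstant_succ hz)]

end Numerals


section Counter
variable {𝔅 : Barber} {n : ℕ} {α β l : Ordinal.{0}} {t w x y z : Tm}

theorem isConstant_counter : counter.IsConstant := uniform_countFm.isConstant_manifestation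

/-- After a limit stage `l`, the counter is empty at the second and the third stage, and takes up
one more numeral every two stages: the fixed point property has a delay of two stages. -/
theorem sat_mem_counter_of_limit (hl : Order.IsSuccLimit l) (hid : ∀ β, l ≤ β → 𝔅.IdStable n β) :
    ∀ (k : ℕ) (w : Tm), w.IsConstant →
      (𝔅.Sat n (l + k + 1 + 1) (isIn w counter) ↔ ∃ j, 2 * j + 2 ≤ k ∧ 𝔅.Eqv n w (num j))
  | 0, w, hw => by
      rw [sat_add_two_mem_counter (hid _ (by simp)) hw]
      simp [not_sat_resetSentence hl]
  | 1, w, hw => by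
      rw [sat_add_two_mem_counter (hid _ (by simp)) hw]
      simp only [Nat.cast_one, not_sat_add_one_resetSentence hl, false_and, false_iff]
      rintro ⟨j, hj, -⟩
      omega
  | k + 2, w, hw => by
      rw [sat_add_two_mem_counter (hid _ (by simp)) hw,
        show l + ((k + 2 : ℕ) : Ordinal) = l + k + 1 + 1 by
          rw [Nat.cast_add, add_assoc, add_assoc]; norm_num]
      simp only [sat_add_two_resetSentence, true_and]
      constructor
      · rintro (h | ⟨z, hz, h1, h2⟩)
        · exact ⟨0, by omega, h⟩
        · obtain ⟨j, hj, h3⟩ := (sat_mem_counter_of_limit hl hid k z hz).1 h1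
          exact ⟨j + 1, by omega, h2.trans hw (isConstant_succ hz) (isConstant_num _)
            (h3.succ hz (isConstant_num j))⟩
      · rintro ⟨j, hj, h⟩
        cases j with
        | zero => exact .inl h
        | succ j => exact .inr ⟨num j, isConstant_num j, (sat_mem_counter_of_limit hl hid k _
            (isConstant_num j)).2 ⟨j, by omega, Eqv.refl (isConstant_num j)⟩, h⟩

/-- At the first limit stage after `l`, the counter has just the numerals as members. -/
theorem sat_add_omega0_mem_counter (hl : Order.IsSuccLimit l)
    (hid : ∀ β, l ≤ β → 𝔅.IdStable n β) (hw : w.IsConstant) :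
    𝔅.Sat n (l + Ordinal.omega0) (isIn w counter) ↔ ∃ j, 𝔅.Eqv n w (num j) := by
  have h0 : l + Ordinal.omega0 ≠ 0 := by simp
  have key : ∀ δ, 𝔅.Sat n δ ((isIn (pair (.var 112) (manifestationBase countFm))
      (manifestationBase countFm)).subst 112 w) ↔ 𝔅.Sat n (δ + 1) (isIn w counter) := fun δ => by
    rw [counter, sat_add_one_mem_manifestation uniform_countFm,
      sat_subst_diagonal uniform_countFm.isConstant_base]
  have key' : 𝔅.Sat n (l + Ordinal.omega0) (isIn w counter) ↔ ∃ γ < l + Ordinal.omega0,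
      ∀ δ, γ ≤ δ → δ < l + Ordinal.omega0 → 𝔅.Sat n (δ + 1) (isIn w counter) := by
    conv_lhs => rw [counter, manifestation_eq, diagonal, sat_abs h0]
    simp only [key]
  rw [key']
  constructor
  · rintro ⟨γ, hγ, h⟩
    obtain ⟨d, hd, hγd⟩ := (Ordinal.lt_add_iff Ordinal.omega0_ne_zero).1 hγ
    obtain ⟨k, rfl⟩ := Ordinal.lt_omega0.1 hd
    have h1 := h (l + k + 1) (hγd.trans (Order.le_succ _))
      (by rw [add_assoc]; gcongr; exact_mod_cast Ordinal.natCast_lt_omega0 (k + 1))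
    obtain ⟨j, -, hj⟩ := (sat_mem_counter_of_limit hl hid k w hw).1 h1
    exact ⟨j, hj⟩
  · rintro ⟨j, hj⟩
    refine ⟨l + (2 * j + 3 : ℕ), by gcongr; exact Ordinal.natCast_lt_omega0 _, fun δ h1 h2 => ?_⟩
    obtain ⟨d, rfl⟩ := le_iff_exists_add.1 ((le_self_add).trans h1)
    obtain ⟨k, rfl⟩ := Ordinal.lt_omega0.1 ((add_lt_add_iff_left l).1 h2)
    have hk : 2 * j + 3 ≤ k := by exact_mod_cast (add_le_add_iff_left l).1 h1
    obtain ⟨m, rfl⟩ : ∃ m, k = m + 1 := ⟨k - 1, by omega⟩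
    have := (sat_mem_counter_of_limit hl hid m w hw).2 ⟨j, by omega, hj⟩
    rwa [Nat.cast_add, ← add_assoc, Nat.cast_one]

end Counter

/-! ### The set of natural numbers -/

section Omega
variable {𝔅 : Barber} {n : ℕ} {α β l : Ordinal.{0}} {t w x y z : Tm}

/-- At the stage `α`, the set `y` has zero and the successors of its members as members. -/
def Inductive (𝔅 : Barber) (n : ℕ) (α : Ordinal.{0}) (y : Tm) : Prop :=
  𝔅.Sat n α (isIn empty y) ∧
    ∀ z : Tm, z.IsConstant → 𝔅.Sat n α (isIn z y) → 𝔅.Sat n α (isIn (succ z) y)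

theorem sat_mem_omega (hα : α ≠ 0) (hx : x.IsConstant) : 𝔅.Sat n α (isIn x omega) ↔
    ∃ γ < α, ∀ δ, γ ≤ δ → δ < α →
      ∀ y : Tm, y.IsConstant → 𝔅.Inductive n δ y → 𝔅.Sat n δ (isIn x y) := by
  rw [omega, sat_abs hα]
  refine exists_congr fun γ => and_congr_right fun _ => forall₃_congr fun δ _ _ => ?_
  rw [subst_all _ _ (by simp), sat_all]
  refine forall₂_congr fun y hy => ?_
  simp [subst_all, subst_var_ne, subst_succ, isConstant_empty.subst, hx.subst, Inductive, sat_all,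
    hy.subst]

theorem Inductive.num (h : 𝔅.Inductive n α y) : ∀ k, 𝔅.Sat n α (isIn (num k) y)
  | 0 => h.1
  | k + 1 => h.2 _ (isConstant_num k) (h.num k)

theorem inductive_omega (hα : α ≠ 0) : 𝔅.Inductive n α omega := by
  constructor
  · exact (sat_mem_omega hα isConstant_empty).2
      ⟨0, pos_iff_ne_zero.2 hα, fun _ _ _ _ _ h => h.1⟩
  · intro z hz h
    obtain ⟨γ, hγ, h⟩ := (sat_mem_omega hα hz).1 h
    exact (sat_mem_omega hα (isConstant_succ hz)).2
      ⟨γ, hγ, fun δ h1 h2 y hy h3 => h3.2 z hz (h δ h1 h2 y hy h3)⟩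

theorem inductive_counter (hl : Order.IsSuccLimit l) (hid : ∀ β, l ≤ β → 𝔅.IdStable n β) :
    𝔅.Inductive n (l + Ordinal.omega0) counter := by
  constructor
  · exact (sat_add_omega0_mem_counter hl hid isConstant_empty).2 ⟨0, Eqv.refl isConstant_empty⟩
  · intro z hz h
    obtain ⟨j, hj⟩ := (sat_add_omega0_mem_counter hl hid hz).1 h
    exact (sat_add_omega0_mem_counter hl hid (isConstant_succ hz)).2
      ⟨j + 1, hj.succ hz (isConstant_num j)⟩

/-- The set `ω` has just the numerals as members from some stage on. At the stage after one where
the counter consists of the numerals, `ω` cannot have other members; and since `ω` is itself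
inductive at all stages but the first, it does not acquire any. -/
theorem decides_mem_omega (hx : x.IsConstant) :
    𝔅.Decides n (isIn x omega) (∃ k, 𝔅.Eqv n x (num k)) := by
  obtain ⟨α, hα⟩ := exists_forall_sat_eqn_iff 𝔅 n
  have hl : Order.IsSuccLimit (α + Ordinal.omega0) :=
    Ordinal.isSuccLimit_add α Ordinal.isSuccLimit_omega0
  have hid : ∀ β, α + Ordinal.omega0 ≤ β → 𝔅.IdStable n β := fun β hβ =>
    hα β (le_self_add.trans hβ)
  set μ := α + Ordinal.omega0 + Ordinal.omega0 with hμ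
  have hμ0 : μ ≠ 0 := by simp [hμ]
  refine ⟨μ + 1, fun β hβ => ⟨?_, ?_⟩⟩
  · induction β using WellFoundedLT.induction with
    | ind β ih =>
      intro h
      have hμβ : μ < β := Order.add_one_le_iff.1 hβ
      obtain ⟨γ, hγ, h⟩ := (sat_mem_omega (zero_le.trans_lt hμβ).ne' hx).1 h
      have h1 := h (max γ μ) (le_max_left _ _) (max_lt hγ hμβ)
      rcases (le_max_right γ μ).eq_or_lt with e | e
      · rw [← e] at h1
        exact (sat_add_omega0_mem_counter hl hid hx).1
          (h1 counter isConstant_counter (inductive_counter hl hid))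
      · exact ih _ (max_lt hγ hμβ) (Order.add_one_le_iff.2 e)
          (h1 omega isConstant_omega (inductive_omega (zero_le.trans_lt e).ne'))
  · rintro ⟨k, hk⟩
    rw [hk.sat_isIn_left hx (isConstant_num k) isConstant_omega]
    exact (inductive_omega (zero_le.trans_lt (Order.add_one_le_iff.1 hβ)).ne').num k

end Omega


/-! ### The well-ordering by least chiffers -/

section Rank
variable {𝔅 : Barber} {n : ℕ} {α β : Ordinal.{0}} {a b t w x y z : Tm}

/-- The least chiffer of a constant that is identical with `a` at all stages. -/
noncomputable def rank (𝔅 : Barber) (n : ℕ) (a : Tm) : ℕ :=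
  sInf {m | ∃ x : Tm, x.IsConstant ∧ x.chiffer = m ∧ m ≤ a.chiffer ∧ 𝔅.Eqv n x a}

theorem exists_chiffer_eq_rank (ha : a.IsConstant) :
    ∃ x : Tm, x.IsConstant ∧ x.chiffer = 𝔅.rank n a ∧ 𝔅.rank n a ≤ a.chiffer ∧ 𝔅.Eqv n x a :=
  Nat.sInf_mem (s := {m | ∃ x : Tm, x.IsConstant ∧ x.chiffer = m ∧ m ≤ a.chiffer ∧ 𝔅.Eqv n x a})
    ⟨a.chiffer, a, ha, rfl, le_rfl, Eqv.refl ha⟩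

theorem rank_le_of_eqv (ha : a.IsConstant) (hb : b.IsConstant) (h : 𝔅.Eqv n a b) :
    𝔅.rank n a ≤ 𝔅.rank n b := by
  obtain ⟨x, hx, h1, -, h2⟩ := exists_chiffer_eq_rank (𝔅 := 𝔅) (n := n) hb
  obtain ⟨-, -, -, h3, -⟩ := exists_chiffer_eq_rank (𝔅 := 𝔅) (n := n) ha
  rcases le_total (𝔅.rank n b) a.chiffer with h' | h'
  · exact Nat.sInf_le ⟨x, hx, h1, h', h2.trans hx hb ha (h.symm ha hb)⟩
  · exact h3.trans h'

/-- By unique readability, a chiffer determines the constant that it denotes. -/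
theorem rank_eq_iff (ha : a.IsConstant) (hb : b.IsConstant) :
    𝔅.rank n a = 𝔅.rank n b ↔ 𝔅.Eqv n a b := by
  constructor
  · intro h
    obtain ⟨x, hx, h1, -, h2⟩ := exists_chiffer_eq_rank (𝔅 := 𝔅) (n := n) ha
    obtain ⟨y, hy, h3, -, h4⟩ := exists_chiffer_eq_rank (𝔅 := 𝔅) (n := n) hb
    obtain rfl : x = y := Tm.chiffer_injective (by rw [h1, h3, h])
    exact (h2.symm hx ha).trans ha hx hb h4
  · exact fun h => le_antisymm (rank_le_of_eqv ha hb h) (rank_le_of_eqv hb ha (h.symm ha hb))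

theorem leastChiffer_eq_rank (hβ : 𝔅.IdStable n β) (ha : a.IsConstant) :
    leastChiffer (𝔅.mem n β) a = 𝔅.rank n a := by
  unfold leastChiffer rank
  congr 1
  ext m
  refine exists_congr fun x => and_congr_right fun hx => and_congr_right fun _ =>
    and_congr_right fun _ => ?_
  rw [← sat_eqn_iff_coessential hx ha, hβ x a hx ha]

theorem decides_le (ha : a.IsConstant) (hb : b.IsConstant) :
    𝔅.Decides n (.le a b) (𝔅.rank n a ≤ 𝔅.rank n b) := by
  obtain ⟨α, hα⟩ := exists_forall_sat_eqn_iff 𝔅 n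
  refine ⟨α, fun β hβ => ?_⟩
  rw [← leastChiffer_eq_rank (hα β hβ) ha, ← leastChiffer_eq_rank (hα β hβ) hb, Sat, Holds]

/-- `m` is the least chiffer of a constant. -/
def IsRank (𝔅 : Barber) (n m : ℕ) : Prop := ∃ t : Tm, t.IsConstant ∧ 𝔅.rank n t = m

theorem infinite_isRank : (Set.ofPred (𝔅.IsRank n)).Infinite :=
  Set.infinite_of_injective_forall_mem (f := fun k => 𝔅.rank n (num k))
    (fun i k h => eqv_num_iff.1 ((rank_eq_iff (isConstant_num i) (isConstant_num k)).1 h))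
    fun k => ⟨num k, isConstant_num k, rfl⟩

/-- The `k`-th of the least chiffers, in increasing order. -/
noncomputable def nthRank (𝔅 : Barber) (n k : ℕ) : ℕ := Nat.nth (𝔅.IsRank n) k

theorem strictMono_nthRank : StrictMono (𝔅.nthRank n) := Nat.nth_strictMono infinite_isRank

theorem exists_rank_eq_nthRank (k : ℕ) : ∃ t : Tm, t.IsConstant ∧ 𝔅.rank n t = 𝔅.nthRank n k :=
  Nat.nth_mem_of_infinite infinite_isRank k

open Classical in
theorem exists_nthRank_eq (ht : t.IsConstant) : ∃ k, 𝔅.rank n t = 𝔅.nthRank n k :=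
  ⟨_, (Nat.nth_count (p := 𝔅.IsRank n) ⟨t, ht, rfl⟩).symm⟩

/-- A constant of least rank among those that are not of one of the first `k` ranks. -/
theorem first_rank_iff {k : ℕ} (hx : x.IsConstant) :
    ((¬ ∃ j < k, 𝔅.rank n x = 𝔅.nthRank n j) ∧ ∀ y : Tm, y.IsConstant →
      (¬ ∃ j < k, 𝔅.rank n y = 𝔅.nthRank n j) → 𝔅.rank n x ≤ 𝔅.rank n y) ↔
      𝔅.rank n x = 𝔅.nthRank n k := by
  have hm := strictMono_nthRank (𝔅 := 𝔅) (n := n)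
  have key : ∀ {i : ℕ}, (¬ ∃ j < k, 𝔅.nthRank n i = 𝔅.nthRank n j) ↔ k ≤ i := by
    intro i
    constructor
    · exact fun h => not_lt.1 fun h' => h ⟨i, h', rfl⟩
    · rintro h ⟨j, hj, e⟩
      have := hm.injective e
      omega
  obtain ⟨i, hi⟩ := exists_nthRank_eq (𝔅 := 𝔅) (n := n) hx
  rw [hi, key]
  constructor
  · rintro ⟨h1, h2⟩
    obtain ⟨t, ht, h3⟩ := exists_rank_eq_nthRank (𝔅 := 𝔅) (n := n) k
    have := h2 t ht (by rw [h3, key])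
    rw [h3, hm.le_iff_le] at this
    rw [le_antisymm this h1]
  · intro h
    rw [hm.injective h]
    refine ⟨le_rfl, fun y hy => ?_⟩
    obtain ⟨l, hl⟩ := exists_nthRank_eq (𝔅 := 𝔅) (n := n) hy
    rw [hl, key, hm.le_iff_le]
    exact id

end Rank

/-! ### Choices -/

section Choice
variable {𝔅 : Barber} {n : ℕ} {α β : Ordinal.{0}} {a b f m t w x y z : Tm} {P : Prop}

theorem decides_mem_univSet (hx : x.IsConstant) : 𝔅.Decides n (isIn x univSet) True := by
  refine Decides.abs ?_
  rw [subst_eqn _ _ _ (by simp), subst_var_self]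
  exact ⟨0, fun β _ => by simp [sat_eqn_self hx]⟩

theorem decides_mem_diff {Q : Prop} (ha : a.IsConstant) (hb : b.IsConstant)
    (h : 𝔅.Decides n (isIn x a) P) (h' : 𝔅.Decides n (isIn x b) Q) :
    𝔅.Decides n (isIn x (diff a b)) (P ∧ ¬ Q) := by
  refine Decides.abs ?_
  simpa [ha.subst, hb.subst] using h.conj fun _ => h'.neg

theorem decides_mem_firstOf {Q : Tm → Prop} (hw : w.IsConstant) (hx : x.IsConstant)
    (h : ∀ y : Tm, y.IsConstant → 𝔅.Decides n (isIn y w) (Q y)) :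
    𝔅.Decides n (isIn x (firstOf w))
      (Q x ∧ ∀ y : Tm, y.IsConstant → Q y → 𝔅.rank n x ≤ 𝔅.rank n y) := by
  refine Decides.abs ?_
  simp only [subst_conj, subst_isIn, subst_var_self, hw.subst, subst_all, ne_eq,
    Nat.reduceEqDiff, not_false_eq_true, subst_imp, subst_le, subst_var_ne]
  refine (h x hx).conj fun _ => Decides.all fun y hy => ?_
  simp only [subst_imp, subst_isIn, subst_var_self, hw.subst, subst_le, hx.subst]
  exact (h y hy).imp fun _ => decides_le hx hy

theorem decides_valueIs {P : Tm → Tm → Prop} (hf : f.IsConstant) (ha : a.IsConstant)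
    (hb : b.IsConstant)
    (h : ∀ x y : Tm, x.IsConstant → y.IsConstant → 𝔅.Decides n (isIn (pair x y) f) (P x y))
    (hP : ∀ x y z : Tm, x.IsConstant → y.IsConstant → z.IsConstant → P x y → P x z →
      𝔅.Eqv n y z) : 𝔅.Decides n (valueIs f a b) (P a b) := by
  have h1 : 𝔅.Decides n (.all 113 (.all 114 (.all 115 (imp
      (conj (isIn (pair (.var 113) (.var 114)) f) (isIn (pair (.var 113) (.var 115)) f))
      (eqn (.var 114) (.var 115)))))) (∀ x, x.IsConstant → ∀ y, y.IsConstant → ∀ z, z.IsConstant →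
        P x y ∧ P x z → 𝔅.Eqv n y z) := by
    refine Decides.all fun x hx => ?_
    rw [subst_all _ _ (by simp)]
    refine Decides.all fun y hy => ?_
    rw [subst_all _ _ (by simp), subst_all _ _ (by simp)]
    refine Decides.all fun z hz => ?_
    simpa [subst_pair, subst_eqn, subst_var_ne, hx.subst, hy.subst, hf.subst] using
      ((h x y hx hy).conj fun _ => h x z hx hz).imp fun _ => decides_eqn hy hz
  exact (h1.conj fun _ => h a b ha hb).congr
    (and_iff_right fun x hx y hy z hz h => hP x y z hx hy hz h.1 h.2)

theorem decides_pair_mem_choice (hw : w.IsConstant) (ha : a.IsConstant) :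
    𝔅.Decides n (isIn (pair w a) choice) (𝔅.Eqv n a (firstOf w)) := by
  refine decides_pair_mem_pairAbs (by simp) (by simp) (by simp) (fun v => ?_) hw ha ?_
  · simp [mem_fv_eqn, mem_fv_firstOf]
    tauto
  · simpa [subst_eqn, subst_firstOf, subst_var_ne, hw.subst] using
      decides_eqn ha (isConstant_firstOf hw)

theorem decides_valueIs_choice (hw : w.IsConstant) (ha : a.IsConstant) :
    𝔅.Decides n (valueIs choice w a) (𝔅.Eqv n a (firstOf w)) :=
  decides_valueIs (P := fun w a => 𝔅.Eqv n a (firstOf w)) isConstant_choice hw ha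
    (fun _ _ => decides_pair_mem_choice) fun _ _ _ hx hy hz h h' =>
      h.trans hy (isConstant_firstOf hx) hz (h'.symm hz (isConstant_firstOf hx))

/-! ### Iterated choices -/

/-- `U ∖ {z | ∃ i (i ∈ m' ∧ z ∈ h∖i)}`, what is left of the universe after the choices up to `m` by
the function `h`. -/
def remainder (h m : Tm) : Tm :=
  diff univSet (.abs 125 (ex 124 (conj (isIn (.var 124) (succ m))
    (memValue (.var 125) h (.var 124)))))

/-- The formula whose manifestation set is the function of the iterated choices. -/
def iterationFm (p h : Tm) : Fm :=
  ex 121 (ex 122 (conj (eqn p (pair (.var 121) (.var 122)))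
    (disj
      (conj (eqn (.var 121) empty) (valueIs choice univSet (.var 122)))
      (ex 123 (conj (isIn (.var 123) omega)
        (conj (eqn (.var 121) (succ (.var 123)))
          (valueIs choice (remainder h (.var 123)) (.var 122))))))))

theorem iteratedChoice_eq : iteratedChoice univSet = manifestation iterationFm := rfl

theorem subst_remainder {v : ℕ} {h : Tm}
    (hv : v ∉ ({100, 101, 102, 108, 113, 114, 115, 116, 124, 125} : Finset ℕ)) :
    (remainder h m).subst v t = remainder (h.subst v t) (m.subst v t) := by
  simp only [Finset.mem_insert, Finset.mem_singleton, not_or, eq_comm (a := v)] at hv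
  simp [remainder, subst_diff, subst_abs, subst_ex, subst_memValue, subst_succ, subst_var_ne,
    isConstant_univSet.subst, hv]

theorem mem_fv_remainder {v : ℕ} {h : Tm} (hv : v ∈ (remainder h m).fv) : v ∈ h.fv ∨ v ∈ m.fv := by
  simp only [remainder, mem_fv_diff, Tm.isConstant_iff.1 isConstant_univSet, Tm.fv, fv_ex, fv_conj,
    fv_isIn, Finset.mem_erase, Finset.mem_union, mem_fv_memValue, mem_fv_succ,
    Finset.mem_singleton] at hv
  tauto

theorem fv_firstOf_remainder {u : ℕ} {h : Tm} (hh : h.IsConstant) (hm : ∀ v ∈ m.fv, v = u) :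
    ∀ v ∈ (firstOf (remainder h m)).fv, v = u := fun v hv =>
  (mem_fv_remainder (mem_fv_firstOf.1 hv).2).elim
    (fun h => absurd h (Tm.isConstant_iff.1 hh v)) (hm v)

theorem isConstant_remainder {h : Tm} (hh : h.IsConstant) (hm : m.IsConstant) :
    (remainder h m).IsConstant :=
  Tm.isConstant_iff.2 fun v hv => (mem_fv_remainder hv).elim (Tm.isConstant_iff.1 hh v)
    (Tm.isConstant_iff.1 hm v)

theorem uniform_iterationFm : Uniform iterationFm where
  fv v hv := by
    simp only [iterationFm, fv_ex, fv_conj, fv_disj, fv_isIn, Finset.mem_erase, Finset.mem_union,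
      mem_fv_eqn, mem_fv_pair, mem_fv_succ, mem_fv_valueIs, Tm.fv, Finset.mem_singleton,
      Tm.isConstant_iff.1 isConstant_empty, Tm.isConstant_iff.1 isConstant_choice,
      Tm.isConstant_iff.1 isConstant_univSet, Tm.isConstant_iff.1 isConstant_omega] at hv
    have h1 : v ∈ (remainder (diagonal (.var 111)) (.var 123)).fv → v = 111 ∨ v = 123 := fun h => by
      simpa [mem_fv_diagonal] using (mem_fv_remainder h).imp_left fun h => (mem_fv_diagonal.1 h).2
    tauto
  subst w z hw hz := by
    simp [iterationFm, subst_ex, subst_eqn, subst_pair, subst_valueIs, subst_succ, subst_remainder,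
      subst_diagonal, subst_var_ne, hw.subst, isConstant_empty.subst, isConstant_choice.subst,
      isConstant_univSet.subst, isConstant_omega.subst]

/-- The values of the function of iterated choices. As the recursion is inside of a term, these
are constants. -/
def iterate : ℕ → Tm
  | 0 => firstOf univSet
  | k + 1 => firstOf (remainder (iteratedChoice univSet) (num k))

theorem isConstant_iterate : ∀ k, (iterate k).IsConstant
  | 0 => isConstant_firstOf isConstant_univSet
  | k + 1 => isConstant_firstOf (isConstant_remainder isConstant_iteratedChoice (isConstant_num k))

theorem Eqv.firstOf_remainder (ha : a.IsConstant) (hb : b.IsConstant) (h : 𝔅.Eqv n a b) :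
    𝔅.Eqv n (firstOf (remainder (iteratedChoice univSet) a))
      (firstOf (remainder (iteratedChoice univSet) b)) := by
  have := h.congr_subst (t := firstOf (remainder (iteratedChoice univSet) (.var 0))) (v := 0) ha hb
    (by simp) (fv_firstOf_remainder isConstant_iteratedChoice (by simp))
  simpa [subst_firstOf, subst_remainder, isConstant_iteratedChoice.subst] using this

theorem decides_pair_mem_iteratedChoice (hm : m.IsConstant) (ha : a.IsConstant) :
    𝔅.Decides n (isIn (pair m a) (iteratedChoice univSet))
      (∃ k, 𝔅.Eqv n m (num k) ∧ 𝔅.Eqv n a (iterate k)) := by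
  have hh := isConstant_iteratedChoice
  have hp := isConstant_pair hm ha
  have key : 𝔅.Decides n (iterationFm (pair m a) (iteratedChoice univSet))
      (∃ s, s.IsConstant ∧ ∃ t, t.IsConstant ∧ (𝔅.Eqv n (pair m a) (pair s t) ∧
        (𝔅.Eqv n s empty ∧ 𝔅.Eqv n t (firstOf univSet) ∨ ∃ i, i.IsConstant ∧
          ((∃ k, 𝔅.Eqv n i (num k)) ∧ (𝔅.Eqv n s (succ i) ∧
            𝔅.Eqv n t (firstOf (remainder (iteratedChoice univSet) i))))))) := by
    refine Decides.ex fun s hs => ?_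
    rw [subst_ex _ _ (by simp)]
    refine Decides.ex fun t ht => ?_
    simp only [subst_conj, subst_disj, subst_eqn, subst_pair, subst_valueIs, subst_var_self,
      hp.subst, hs.subst, hh.subst, isConstant_choice.subst, isConstant_univSet.subst,
      isConstant_empty.subst, subst_var_ne, subst_ex, ne_eq, Nat.reduceEqDiff, not_false_eq_true,
      subst_isIn, isConstant_omega.subst, subst_succ, subst_remainder, Finset.mem_insert,
      Finset.mem_singleton, or_self]
    refine (decides_eqn hp (isConstant_pair hs ht)).conj fun _ => Decides.disj
      ((decides_eqn hs isConstant_empty).conj fun _ => decides_valueIs_choice isConstant_univSet ht)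
      (Decides.ex fun i hi => ?_)
    simp only [subst_conj, subst_eqn, subst_valueIs, subst_var_self,
      hs.subst, ht.subst, hh.subst, isConstant_choice.subst, ne_eq, Nat.reduceEqDiff,
      not_false_eq_true, subst_isIn, isConstant_omega.subst, subst_succ, subst_remainder,
      Finset.mem_insert, Finset.mem_singleton, or_self]
    exact (decides_mem_omega hi).conj fun _ => (decides_eqn hs (isConstant_succ hi)).conj fun _ =>
      decides_valueIs_choice (isConstant_remainder hh hi) ht
  rw [iteratedChoice_eq] at key ⊢
  refine (decides_mem_manifestation uniform_iterationFm hp key).congr ?_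
  rw [← iteratedChoice_eq]
  constructor
  · rintro ⟨s, hs, t, ht, h, h1 | ⟨i, hi, ⟨k, hk⟩, h1, h2⟩⟩
    · rw [eqv_pair_iff hm ha hs ht] at h
      exact ⟨0, h.1.trans hm hs isConstant_empty h1.1, h.2.trans ha ht (isConstant_iterate 0) h1.2⟩
    · rw [eqv_pair_iff hm ha hs ht] at h
      have hk' := isConstant_num k
      exact ⟨k + 1, h.1.trans hm hs (isConstant_succ hk')
          (h1.trans hs (isConstant_succ hi) (isConstant_succ hk') (hk.succ hi hk')),
        h.2.trans ha ht (isConstant_iterate (k + 1)) (h2.trans ht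
          (isConstant_firstOf (isConstant_remainder hh hi)) (isConstant_iterate (k + 1))
          (hk.firstOf_remainder hi hk'))⟩
  · rintro ⟨k, h1, h2⟩
    refine ⟨m, hm, a, ha, Eqv.refl hp, ?_⟩
    cases k with
    | zero => exact .inl ⟨h1, h2⟩
    | succ k => exact .inr ⟨num k, isConstant_num k, ⟨k, Eqv.refl (isConstant_num k)⟩, h1, h2⟩

theorem decides_memValue_iteratedChoice {k : ℕ} (hm : m.IsConstant) (hx : x.IsConstant)
    (hk : 𝔅.Eqv n m (num k)) (h : 𝔅.Decides n (isIn x (iterate k)) P) :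
    𝔅.Decides n (memValue x (iteratedChoice univSet) m) P := by
  have key : 𝔅.Decides n (memValue x (iteratedChoice univSet) m) (∃ y, y.IsConstant ∧
      ((∃ i, 𝔅.Eqv n m (num i) ∧ 𝔅.Eqv n y (iterate i)) ∧ P)) := by
    refine Decides.ex fun y hy => ?_
    simp only [subst_conj, subst_valueIs, subst_isIn, subst_var_self,
      isConstant_iteratedChoice.subst, hm.subst, hx.subst, ne_eq, Nat.reduceEqDiff,
      not_false_eq_true]
    refine (decides_valueIs (P := fun m y => ∃ i, 𝔅.Eqv n m (num i) ∧ 𝔅.Eqv n y (iterate i))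
      isConstant_iteratedChoice hm hy
      (fun _ _ => decides_pair_mem_iteratedChoice) ?_).conj ?_
    · rintro a y z ha hy hz ⟨i, h1, h2⟩ ⟨j, h3, h4⟩
      obtain rfl := eqv_num_unique ha h1 h3
      exact h2.trans hy (isConstant_iterate i) hz (h4.symm hz (isConstant_iterate i))
    · rintro ⟨i, h1, h2⟩
      obtain rfl := eqv_num_unique hm hk h1
      exact h.of_sat_iff fun _ => (h2.sat_isIn_right hy (isConstant_iterate k) hx).symm
  refine key.congr ⟨fun ⟨y, hy, h⟩ => h.2, fun h => ?_⟩
  exact ⟨_, isConstant_iterate k, ⟨k, hk, Eqv.refl (isConstant_iterate k)⟩, h⟩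

theorem decides_mem_remainder {k : ℕ} (hx : x.IsConstant) {Q : ℕ → Prop}
    (h : ∀ j < k + 1, 𝔅.Decides n (isIn x (iterate j)) (Q j)) :
    𝔅.Decides n (isIn x (remainder (iteratedChoice univSet) (num k))) (¬ ∃ j < k + 1, Q j) := by
  have hh := isConstant_iteratedChoice
  have hk := isConstant_num k
  have hc : (Tm.abs 125 (ex 124 (conj (isIn (.var 124) (succ (num k)))
      (memValue (.var 125) (iteratedChoice univSet) (.var 124))))).IsConstant :=
    isConstant_abs fun v hv => by
      simp only [fv_ex, fv_conj, fv_isIn, Finset.mem_erase, Finset.mem_union, mem_fv_memValue,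
        mem_fv_succ, Tm.fv, Finset.mem_singleton, Tm.isConstant_iff.1 hh,
        Tm.isConstant_iff.1 hk] at hv
      tauto
  refine (decides_mem_diff isConstant_univSet hc (decides_mem_univSet hx) (Decides.abs ?_)).congr
    (iff_of_eq (true_and _))
  refine Decides.congr (P := ∃ i, i.IsConstant ∧ ((∃ j < k + 1, 𝔅.Eqv n i (num j)) ∧
    ∃ j < k + 1, 𝔅.Eqv n i (num j) ∧ Q j)) ?_ ?_
  · rw [subst_ex _ _ (by simp)]
    refine Decides.ex fun i hi => ?_
    simp only [subst_conj, subst_memValue, subst_isIn, subst_var_self, hh.subst, subst_var_ne,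
      (isConstant_succ hk).subst, hx.subst, ne_eq, Nat.reduceEqDiff, not_false_eq_true]
    refine (decides_mem_num (k := k + 1) hi).conj ?_
    rintro ⟨j, hj, hij⟩
    refine (decides_memValue_iteratedChoice hi hx hij (h j hj)).congr
      ⟨fun h => ⟨j, hj, hij, h⟩, ?_⟩
    rintro ⟨l, -, hl, h⟩
    rwa [eqv_num_unique hi hij hl]
  · constructor
    · rintro ⟨i, -, -, j, hj, -, h⟩
      exact ⟨j, hj, h⟩
    · rintro ⟨j, hj, h⟩
      have hr := Eqv.refl (𝔅 := 𝔅) (n := n) (isConstant_num j)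
      exact ⟨num j, isConstant_num j, ⟨j, hj, hr⟩, j, hj, hr, h⟩

/-- The `k`-th choice has just the constants of the `k`-th rank as members. -/
theorem decides_mem_iterate : ∀ (k : ℕ) {x : Tm}, x.IsConstant →
    𝔅.Decides n (isIn x (iterate k)) (𝔅.rank n x = 𝔅.nthRank n k) := by
  intro k
  induction k using Nat.strong_induction_on with
  | _ k ih =>
    intro x hx
    refine Decides.congr ?_ (first_rank_iff hx)
    cases k with
    | zero =>
      refine decides_mem_firstOf (Q := fun y => ¬ ∃ j < 0, 𝔅.rank n y = 𝔅.nthRank n j)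
        isConstant_univSet hx fun y hy => ?_
      exact (decides_mem_univSet hy).congr (by simp)
    | succ k =>
      refine decides_mem_firstOf (Q := fun y => ¬ ∃ j < k + 1, 𝔅.rank n y = 𝔅.nthRank n j)
        (isConstant_remainder isConstant_iteratedChoice (isConstant_num k)) hx fun y hy => ?_
      exact decides_mem_remainder hy fun j hj => ih j hj hy

/-! ### The enumerator -/

theorem decides_enumerator_matrix (hm : m.IsConstant) (hx : x.IsConstant) :
    𝔅.Decides n (((conj (isIn (.var 126) omega) (memValue (.var 127) (iteratedChoice univSet)
      (.var 126))).subst 126 m).subst 127 x)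
      (∃ k, 𝔅.Eqv n m (num k) ∧ 𝔅.rank n x = 𝔅.nthRank n k) := by
  simp only [subst_conj, subst_memValue, subst_isIn, subst_var_self, subst_var_ne, hm.subst,
    isConstant_omega.subst, isConstant_iteratedChoice.subst, ne_eq, Nat.reduceEqDiff,
    not_false_eq_true]
  refine Decides.congr ((decides_mem_omega hm).conj
    (Q := ∃ k, 𝔅.Eqv n m (num k) ∧ 𝔅.rank n x = 𝔅.nthRank n k) ?_)
    (and_iff_right_of_imp fun ⟨k, h, _⟩ => ⟨k, h⟩)
  rintro ⟨k, hk⟩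
  refine (decides_memValue_iteratedChoice hm hx hk (decides_mem_iterate k hx)).congr
    ⟨fun h => ⟨k, hk, h⟩, ?_⟩
  rintro ⟨l, hl, h⟩
  rwa [eqv_num_unique hm hk hl]

theorem fv_enumerator_matrix {f : Tm} (ha : a.IsConstant) (hf : f.IsConstant) :
    ∀ v ∈ (conj (isIn (.var 126) a) (memValue (.var 127) f (.var 126))).fv, v = 126 ∨ v = 127 := by
  simp [mem_fv_memValue, Tm.isConstant_iff.1 ha, Tm.isConstant_iff.1 hf]
  tauto

theorem decides_pair_mem_enumerator (hm : m.IsConstant) (hx : x.IsConstant) :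
    𝔅.Decides n (isIn (pair m x) enumerator)
      (∃ k, 𝔅.Eqv n m (num k) ∧ 𝔅.rank n x = 𝔅.nthRank n k) :=
  decides_pair_mem_pairAbs (by simp) (by simp) (by simp)
    (fv_enumerator_matrix isConstant_omega isConstant_iteratedChoice) hm hx
    (decides_enumerator_matrix hm hx)

theorem decides_mem_enumerator (hx : x.IsConstant) : 𝔅.Decides n (isIn x enumerator)
    (∃ s, s.IsConstant ∧ ∃ t, t.IsConstant ∧ 𝔅.Eqv n x (pair s t) ∧
      ∃ k, 𝔅.Eqv n s (num k) ∧ 𝔅.rank n t = 𝔅.nthRank n k) :=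
  decides_mem_pairAbs (P := fun s t => ∃ k, 𝔅.Eqv n s (num k) ∧ 𝔅.rank n t = 𝔅.nthRank n k)
    (by simp) (by simp) (by simp)
    (fv_enumerator_matrix isConstant_omega isConstant_iteratedChoice) hx fun _ _ =>
      decides_enumerator_matrix

/-- Having an eventual truth value, each membership in the enumerator is eventually claimed or
denied by `𝒯`. -/
theorem decides_orthodox : 𝔅.Decides n
    (.all 0 (disj (tr (isIn (.var 0) enumerator)) (tr (neg (isIn (.var 0) enumerator))))) True := by
  refine (Decides.all (P := fun _ => True) fun t ht => ?_).congr (by simp)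
  simp only [subst_disj, subst_tr, subst_neg, subst_isIn, subst_var_self,
    isConstant_enumerator.subst]
  exact ((decides_mem_enumerator ht).tr.disj (decides_mem_enumerator ht).neg.tr).congr
    (iff_true_intro (em _))

theorem decides_bijection : 𝔅.Decides n (bijection enumerator omega univSet) True := by
  have hE := isConstant_enumerator
  have hU := isConstant_univSet
  have hO := isConstant_omega
  refine Decides.congr (Decides.conj (P := True) ?_ fun _ => Decides.conj (P := True) ?_ fun _ =>
    Decides.conj (P := True) ?_ fun _ => Decides.conj (P := True) (Q := True) ?_ fun _ => ?_)
    (by simp)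
  -- members are pairs of a natural number and a set
  · refine (Decides.all (P := fun _ => True) fun p hp => ?_).congr (by simp)
    simp only [subst_imp, subst_isIn, subst_var_self, hE.subst, subst_ex, subst_conj, subst_eqn,
      subst_pair, subst_var_ne, hO.subst, hU.subst, ne_eq, Nat.reduceEqDiff, not_false_eq_true]
    refine ((decides_mem_enumerator hp).imp fun _ => Decides.ex (P := fun s => ∃ t, t.IsConstant ∧
      (𝔅.Eqv n p (pair s t) ∧ (∃ k, 𝔅.Eqv n s (num k)) ∧ True)) fun s hs => ?_).congr
      (iff_true_intro ?_)
    · rw [subst_ex _ _ (by simp)]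
      refine Decides.ex fun t ht => ?_
      simp only [subst_isIn, subst_var_self, subst_conj, subst_eqn, hp.subst, hs.subst,
        subst_pair, subst_var_ne, hO.subst, hU.subst, ne_eq, Nat.reduceEqDiff, not_false_eq_true]
      exact (decides_eqn hp (isConstant_pair hs ht)).conj fun _ => (decides_mem_omega hs).conj
        fun _ => decides_mem_univSet ht
    · rintro ⟨s, hs, t, ht, h, k, hk, -⟩
      exact ⟨s, hs, t, ht, h, ⟨k, hk⟩, trivial⟩
  -- total, as there are infinitely many ranks
  · refine (Decides.all (P := fun _ => True) fun m hm => ?_).congr (by simp)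
    simp only [subst_imp, subst_isIn, subst_var_self, hE.subst, subst_ex, subst_pair, subst_var_ne,
      hO.subst, ne_eq, Nat.reduceEqDiff, not_false_eq_true]
    refine ((decides_mem_omega hm).imp fun _ => Decides.ex fun x hx => ?_).congr
      (Q := True) (P := _ → ∃ x, x.IsConstant ∧ ∃ k, 𝔅.Eqv n m (num k) ∧
        𝔅.rank n x = 𝔅.nthRank n k) (iff_true_intro ?_)
    · simpa [subst_pair, hm.subst, hE.subst] using decides_pair_mem_enumerator hm hx
    · rintro ⟨k, hk⟩
      obtain ⟨x, hx, h⟩ := exists_rank_eq_nthRank (𝔅 := 𝔅) (n := n) k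
      exact ⟨x, hx, k, hk, h⟩
  -- functional, as constants of the same rank are identical
  · refine (Decides.all (P := fun _ => True) fun m hm => ?_).congr (by simp)
    rw [subst_all _ _ (by simp), subst_all _ _ (by simp)]
    refine (Decides.all (P := fun _ => True) fun x hx => ?_).congr (by simp)
    rw [subst_all _ _ (by simp)]
    refine (Decides.all (P := fun _ => True) fun y hy => ?_).congr (by simp)
    simp only [subst_imp, subst_isIn, subst_var_self, hE.subst, subst_conj, subst_eqn,
      subst_pair, subst_var_ne, hm.subst, hx.subst, ne_eq, Nat.reduceEqDiff, not_false_eq_true]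
    refine (((decides_pair_mem_enumerator hm hx).conj fun _ =>
      decides_pair_mem_enumerator hm hy).imp fun _ => decides_eqn hx hy).congr (iff_true_intro ?_)
    rintro ⟨⟨i, h1, h2⟩, ⟨j, h3, h4⟩⟩
    obtain rfl := eqv_num_unique hm h1 h3
    exact (rank_eq_iff hx hy).1 (h2.trans h4.symm)
  -- injective, as the enumeration of the ranks is strictly increasing
  · refine (Decides.all (P := fun _ => True) fun l hl => ?_).congr (by simp)
    rw [subst_all _ _ (by simp), subst_all _ _ (by simp)]
    refine (Decides.all (P := fun _ => True) fun m hm => ?_).congr (by simp)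
    rw [subst_all _ _ (by simp)]
    refine (Decides.all (P := fun _ => True) fun x hx => ?_).congr (by simp)
    simp only [subst_imp, subst_isIn, subst_var_self, hE.subst, subst_conj, subst_eqn,
      subst_pair, subst_var_ne, hl.subst, hm.subst, ne_eq, Nat.reduceEqDiff, not_false_eq_true]
    refine (((decides_pair_mem_enumerator hl hx).conj fun _ =>
      decides_pair_mem_enumerator hm hx).imp fun _ => decides_eqn hl hm).congr (iff_true_intro ?_)
    rintro ⟨⟨i, h1, h2⟩, ⟨j, h3, h4⟩⟩
    obtain rfl := strictMono_nthRank.injective (h2.symm.trans h4)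
    exact h1.trans hl (isConstant_num i) hm (h3.symm hm (isConstant_num i))
  -- onto, as each constant has a rank
  · refine (Decides.all (P := fun _ => True) fun x hx => ?_).congr (by simp)
    simp only [subst_imp, subst_isIn, subst_var_self, hE.subst, subst_ex, subst_conj, subst_pair,
      subst_var_ne, hO.subst, hU.subst, ne_eq, Nat.reduceEqDiff, not_false_eq_true]
    refine ((decides_mem_univSet hx).imp fun _ => Decides.ex (P := fun m =>
      (∃ k, 𝔅.Eqv n m (num k)) ∧ ∃ k, 𝔅.Eqv n m (num k) ∧ 𝔅.rank n x = 𝔅.nthRank n k)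
      fun m hm => ?_).congr (iff_true_intro fun _ => ?_)
    · simpa [subst_pair, hx.subst, hE.subst, hO.subst] using (decides_mem_omega hm).conj fun _ =>
        decides_pair_mem_enumerator hm hx
    · obtain ⟨k, hk⟩ := exists_nthRank_eq (𝔅 := 𝔅) (n := n) hx
      have hr := Eqv.refl (𝔅 := 𝔅) (n := n) (isConstant_num k)
      exact ⟨num k, isConstant_num k, ⟨k, hr⟩, k, hr, hk⟩

end Choice

/-! ### The closure ordinal -/

section Closure
variable {𝔅 : Barber} {A : Fm}

theorem In.exists_forall_sat (h : 𝔅.In A) : ∃ α, ∀ β, α ≤ β → ∀ n, 𝔅.Sat n β A := by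
  obtain ⟨α, h⟩ := h
  exact ⟨α, fun β hβ n => sat_tr_add_one.1 (h (β + 1) (hβ.trans (Order.le_succ β)) n)⟩

theorem inFrom_of_forall_sat {α β : Ordinal.{0}} (h : ∀ γ, α ≤ γ → ∀ n, 𝔅.Sat n γ A)
    (hαβ : α < β) : 𝔅.InFrom β A := fun _ hγ n =>
  (sat_tr (zero_le.trans_lt (hαβ.trans_le hγ)).ne').2
    ⟨α, hαβ.trans_le hγ, fun δ hδ _ => h δ hδ n⟩

theorem in_of_decides (h : ∀ n, 𝔅.Decides n A True) : 𝔅.In A := by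
  obtain ⟨α, hα⟩ := exists_forall_ge h
  exact ⟨α + 1, inFrom_of_forall_sat (fun _ hγ n => (hα _ hγ n).2 trivial) (lt_add_one α)⟩

/-- The limit of stages that lie so far apart that between two of them each sentence fails at some
stage unless it holds from the earlier one on. -/
theorem exists_stabilizes (𝔅 : Barber) : ∃ α, ∀ A, 𝔅.Stabilizes α A := by
  have h1 : ∀ i : Fm, ∃ α, ∀ β, α ≤ β → 𝔅.In i → ∀ n, 𝔅.Sat n β i := fun i => by
    by_cases h : 𝔅.In i
    · obtain ⟨α, hα⟩ := h.exists_forall_sat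
      exact ⟨α, fun β hβ _ => hα β hβ⟩
    · exact ⟨0, fun β _ h' => absurd h' h⟩
  obtain ⟨c, hc⟩ := exists_forall_ge h1
  have h2 : ∀ γ, ∃ γ', γ ≤ γ' ∧ ∀ A n, (∀ δ, γ ≤ δ → δ < γ' → 𝔅.Sat n δ A) →
      ∀ δ, γ ≤ δ → 𝔅.Sat n δ A := fun γ => by
    have : ∀ i : Fm × ℕ, ∃ α, ∀ β, α ≤ β → (∀ δ, γ ≤ δ → δ < β → 𝔅.Sat i.2 δ i.1) →
        ∀ δ, γ ≤ δ → 𝔅.Sat i.2 δ i.1 := fun i => by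
      by_cases h : ∀ δ, γ ≤ δ → 𝔅.Sat i.2 δ i.1
      · exact ⟨0, fun _ _ _ => h⟩
      · push Not at h
        obtain ⟨δ, h1, h2⟩ := h
        exact ⟨δ + 1, fun β hβ h3 => absurd (h3 δ h1 (Order.add_one_le_iff.1 hβ)) h2⟩
    obtain ⟨γ', h⟩ := exists_forall_ge this
    exact ⟨max γ γ', le_max_left _ _, fun A n => h _ (le_max_right _ _) (A, n)⟩
  choose g hg hg' using h2
  set s : ℕ → Ordinal.{0} := fun k => g^[k] (c + 1) with hs
  have hs1 : ∀ k, s (k + 1) = g (s k) := fun k => Function.iterate_succ_apply' g k (c + 1)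
  have hle : ∀ k, s k ≤ ⨆ k, s k := Ordinal.le_iSup s
  have hcs : c < ⨆ k, s k := (lt_add_one c).trans_le (hle 0)
  refine ⟨⨆ k, s k, fun A => ⟨fun hA => ?_, fun hA => ?_⟩⟩
  · exact inFrom_of_forall_sat (fun _ hγ => hc _ hγ A hA) hcs
  · refine in_of_decides fun n => ?_
    obtain ⟨γ, hγ, h⟩ := (sat_tr (zero_le.trans_lt hcs).ne').1 (hA n)
    obtain ⟨k, hk⟩ := Ordinal.lt_iSup_iff.1 hγ
    refine ⟨s k, fun β hβ => iff_true_intro (hg' (s k) A n (fun δ h1 h2 => ?_) β hβ)⟩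
    exact h δ (hk.le.trans h1) (h2.trans_le (hs1 k ▸ hle (k + 1)))

theorem inFrom_closure (hA : A.IsSentence) (h : 𝔅.In A) : 𝔅.InFrom 𝔅.closure A := by
  obtain ⟨α, hα⟩ := 𝔅.exists_stabilizes
  exact ((csInf_mem (s := {α | ∀ A : Fm, A.IsSentence → 𝔅.Stabilizes α A})
    ⟨α, fun A _ => hα A⟩) A hA).1 h

theorem maxim_of_in (hA : A.IsSentence) (h : 𝔅.In A) : 𝔅.Maxim A :=
  inFrom_closure hA h _ le_rfl

/-- `𝒯⌜A⌝` holds at the stage after the closure ordinal just if `A` holds at the closure ordinal. -/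
theorem optimum_of_in (hA : A.IsSentence) (h : 𝔅.In A) : 𝔅.Optimum A := fun n =>
  sat_tr_add_one.1 (inFrom_closure hA h (𝔅.closure + 1) (Order.le_succ _) n)

end Closure

end Barber
end Librationism

open Librationism Librationism.Barber in
theorem mainTheorem4 (𝔅 : Librationism.Barber) :
    𝔅.OrthodoxSet Librationism.enumerator ∧
    𝔅.Maxim (Librationism.bijection Librationism.enumerator Librationism.omega
      Librationism.univSet) ∧
    𝔅.Maxim (Librationism.ex 0 (Librationism.bijection (Librationism.Tm.var 0) Librationism.omega
      Librationism.univSet)) := by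
  refine ⟨optimum_of_in ?_ (in_of_decides fun _ => decides_orthodox),
    maxim_of_in ?_ (in_of_decides fun _ => decides_bijection),
    maxim_of_in ?_ (in_of_decides fun n => ?_)⟩
  · rw [Fm.isSentence_iff]
    simp [Tm.isConstant_iff.1 isConstant_enumerator]
  · exact isSentence_bijection isConstant_enumerator isConstant_omega isConstant_univSet
  · exact isSentence_ex_bijection isConstant_omega isConstant_univSet
  -- the enumerator is a witness
  · obtain ⟨α, h⟩ := decides_bijection (𝔅 := 𝔅) (n := n)
    refine ⟨α, fun β hβ => iff_true_intro (sat_ex.2 ⟨_, isConstant_enumerator, ?_⟩)⟩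
    simpa [bijection, subst_all, subst_ex, subst_eqn, subst_pair, subst_var_ne,
      isConstant_omega.subst, isConstant_univSet.subst] using (h β hβ).2 trivial
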